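/- **Setting.** Let $k\ge 1$, ${\bf n}=(n_1,\dots,n_k)$ and ${\bf m}=(m_1,\dots,m_k)$ with $n_i,m_i\in\{1,2,\dots\}$. Let $\mathbb F_{n_i}^+$ be the free monoid on $g^i_1,\dots,g^i_{n_i}$, with identity $g^i_0$, and let ${\bf f}=(f_1,\dots,f_k)$, where $f_i=\sum_{\alpha\in\mathbb F_{n_i}^+}a_{i,\alpha}Z_\alpha$ is a positive regular free holomorphic function: $a_{i,\alpha}\ge 0$, $a_{i,g_0^i}=0$, $a_{i,g_j^i}>0$ for all $j$, and $\limsup_{p\to\infty}\big(\sum_{|\alpha|=p}|a_{i,\alpha}|^2\big)^{1/2p}<\infty$. For a complex Hilbert space $\mathcal H$ and $X_i\in B(\mathcal H)^{n_i}$ put $\Phi_{f_i,X_i}(Y)=\sum_\alpha a_{i,\alpha}X_{i,\alpha}YX_{i,\alpha}^*$ (weak operator topology) and ${\bf \Delta}^{\bf p}_{\bf f,X}=(id-\Phi_{f_1,X_1})^{p_1}\cdots(id-\Phi_{f_k,X_k})^{p_k}$. The polydomain ${\bf D_f^m}(\mathcal H)$ is the set of all ${\bf X}=(X_1,\dots,X_k)$,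 $X_i=(X_{i,1},\dots,X_{i,n_i})\in B(\mathcal H)^{n_i}$, such that the entries of $X_p$ commute with those of $X_q$ for $p\ne q$, each series $\Phi_{f_i,X_i}(I)$ converges with $\Phi_{f_i,X_i}(I)\le I$, and ${\bf \Delta}_{\bf f,X}^{(\epsilon_1m_1,\dots,\epsilon_km_k)}(I)\ge 0$ for all $\epsilon_i\in\{0,1\}$. Such an ${\bf X}$ is *pure* if $\lim_{{\bf q}\in\mathbb Z_+^k}(id-\Phi_{f_k,X_k}^{q_k})\cdots(id-\Phi_{f_1,X_1}^{q_1})(I)=I$, and *completely non-coisometric* if there is no $h\ne 0$ with $\langle(id-\Phi_{f_1,X_1}^{q_1})\cdots(id-\Phi_{f_k,X_k}^{q_k})(I)h,h\rangle=0$ for all $q_1,\dots,q_k\ge 1$. Let $b_{i,g_0^i}=1$ and $b_{i,\alpha}=\sum_{p=1}^{|\alpha|}\sum_{\gamma_1\cdots\gamma_p=\alpha,\ |\gamma_s|\ge1}a_{i,\gamma_1}\cdots a_{i,\gamma_p}\binom{p+m_i-1}{m_i-1}$ for $|\alpha|\ge 1$. Let $F^2=F^2(H_{n_1})\otimes\cdots\otimes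 F^2(H_{n_k})$ be the tensor product of full Fock spaces with orthonormal basis $e^1_{\beta_1}\otimes\cdots\otimes e^k_{\beta_k}$, $\beta_i\in\mathbb F_{n_i}^+$, and let ${\bf W}_{i,j}$ act on the $i$-th factor by $e^i_\alpha\mapsto\sqrt{b_{i,\alpha}}/\sqrt{b_{i,g_j\alpha}}\;e^i_{g_j\alpha}$ and trivially on the others. An operator $M:F^2\otimes\mathcal E\to F^2\otimes\mathcal G$ is *multi-analytic* if $M({\bf W}_{i,j}\otimes I)=({\bf W}_{i,j}\otimes I)M$ for all $i,j$, and *inner* if it is moreover a partial isometry. For ${\bf X}\in{\bf D_f^m}(\mathcal H)$ put $\mathcal D_{\bf X}=\overline{{\bf\Delta_{f,X}^m}(I)\mathcal H}$; the Berezin kernel ${\bf K_{f,X}}:\mathcal H\to F^2\otimes\mathcal D_{\bf X}$ is $${\bf K_{f,X}}h=\sum_{\beta_1,\dots,\beta_k}\sqrt{b_{1,\beta_1}}\cdots\sqrt{b_{k,\beta_k}}\;e^1_{\beta_1}\otimes\cdots\otimes e^k_{\beta_k}\otimes{\bf\Delta_{f,X}^m}(I)^{1/2}X_{1,\beta_1}^*\cdots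 X_{k,\beta_k}^*h.$$ Let $\mathcal C_{\bf f}^{\bf m}(\mathcal H)$ be the set of all ${\bf T}\in{\bf D_f^m}(\mathcal H)$ for which there are a Hilbert space $\mathcal E$ and a multi-analytic operator $\Psi:F^2\otimes\mathcal E\to F^2\otimes\mathcal D_{\bf T}$ with ${\bf K_{f,T}}{\bf K_{f,T}^*}+\Psi\Psi^*=I$. For such ${\bf T}$ let $Y=I-{\bf K_{f,T}}{\bf K_{f,T}^*}$ and $\mathcal M_{\bf T}=\overline{{\rm range}\,Y}$, let $A_{i,j}\in B(\mathcal M_{\bf T})$ be the operator determined by $A_{i,j}Y^{1/2}x=Y^{1/2}({\bf W}_{i,j}^*\otimes I)x$ for all $x\in F^2\otimes\mathcal D_{\bf T}$, and let ${\bf M_T}=(A_{i,j}^*)$. The characteristic function of ${\bf T}$ is $\Theta_{\bf f,T}=Y^{1/2}\,{\bf K}_{{\bf f},{\bf M_T}}^*:F^2\otimes\mathcal D_{{\bf M_T}}\to F^2\otimes\mathcal D_{\bf T}$. **Theorem.** Let ${\bf T}\in\mathcal C_{\bf f}^{\bf m}(\mathcal H)$. Then the operators used to define $\Theta_{\bf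 f,T}$ (that is, the bounded operators ${\bf K_{f,T}}$, $A_{i,j}$ and ${\bf K}_{{\bf f},{\bf M_T}}$) exist, and: 1. If ${\bf T}$ is completely non-coisometric, then ${\bf T}$ is pure if and only if $\Theta_{\bf f,T}$ is an inner multi-analytic operator. 2. If ${\bf T}$ is pure (whether or not it is assumed completely non-coisometric), then $\Theta_{\bf f,T}$ is an inner multi-analytic operator, and ${\bf T}$ is unitarily equivalent to ${\bf G}=(G_{i,j})$, $G_{i,j}=P_{\bf H_{f,T}}({\bf W}_{i,j}\otimes I)|_{\bf H_{f,T}}$, where ${\bf H_{f,T}}=(F^2\otimes\mathcal D_{\bf T})\ominus{\rm range}\,\Theta_{\bf f,T}$; that is, $T_{i,j}=U^*G_{i,j}U$ for all $i,j$, for some unitary $U:\mathcal H\to{\bf H_{f,T}}$. -/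

import Mathlib

open scoped ENNReal InnerProduct

noncomputable section

namespace Polydomain

universe u v

/-! ### Positive regular free holomorphic functions and their weights -/

/-- A positive regular free holomorphic function `f = ∑ a_α Z_α` in `n` noncommuting
indeterminates, given by its coefficients, indexed by the words of the free monoid. -/
structure PosRegular (n : ℕ) where
  coeff : FreeMonoid (Fin n) → ℝ
  coeff_nonneg : ∀ α, 0 ≤ coeff α
  coeff_one : coeff 1 = 0
  coeff_of_pos : ∀ j, 0 < coeff (FreeMonoid.of j)
  /-- `limsup_p (∑_{|α| = p} |a_α|²)^{1/(2p)} < ∞`. -/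
  limsup_lt_top :
    Filter.limsup (fun p : ℕ =>
      ENNReal.ofReal ((∑ w : Fin p → Fin n,
        |coeff (FreeMonoid.ofList (List.ofFn w))| ^ 2) ^ (1 / (2 * (p : ℝ))))) Filter.atTop < ⊤

/-- The weight `b_α^{(m)} = ∑_p ∑_{γ₁⋯γ_p = α, |γ_s| ≥ 1} a_{γ₁}⋯a_{γ_p} (p+m-1 choose m-1)`.
The factorizations of `α` into nonempty words are its splittings along the compositions of `|α|`;
the empty word has exactly one (empty) factorization, so that its weight is `1`. -/
def weight {n : ℕ} (f : PosRegular n) (m : ℕ) (α : FreeMonoid (Fin n)) : ℝ :=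
  ∑ c : Composition (FreeMonoid.toList α).length,
    (((FreeMonoid.toList α).splitWrtComposition c).map
        fun γ => f.coeff (FreeMonoid.ofList γ)).prod *
      ((c.length + m - 1).choose (m - 1) : ℝ)

theorem weight_one {n : ℕ} (f : PosRegular n) (m : ℕ) : weight f m 1 = 1 := by
  have key : ∀ l : List (Fin n), l.length = 0 →
      ∑ c : Composition l.length,
        ((l.splitWrtComposition c).map fun γ => f.coeff (FreeMonoid.ofList γ)).prod *
        ((c.length + m - 1).choose (m - 1) : ℝ) = 1 := by
    intro l hl
    obtain rfl := List.length_eq_zero_iff.mp hl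
    have h0 : ∀ c : Composition ([] : List (Fin n)).length, c.blocks = [] := fun c => by
      have := c.blocks_sum
      rcases hb : c.blocks with _ | ⟨a, t⟩
      · rfl
      · have hp := c.blocks_pos (i := a) (by simp [hb])
        rw [hb] at this
        simp at this
        omega
    have hsub : Subsingleton (Composition ([] : List (Fin n)).length) :=
      ⟨fun c d => Composition.ext ((h0 c).trans (h0 d).symm)⟩
    rw [Fintype.sum_subsingleton _ (default : Composition ([] : List (Fin n)).length)]
    simp [List.splitWrtComposition, List.splitWrtCompositionAux, Composition.length, h0]
  exact key _ rfl

theorem weight_nonneg {n : ℕ} (f : PosRegular n) (m : ℕ) (α : FreeMonoid (Fin n)) :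
    0 ≤ weight f m α := by
  refine Finset.sum_nonneg fun c _ => mul_nonneg (List.prod_nonneg ?_) (by positivity)
  intro a ha
  obtain ⟨γ, _, rfl⟩ := List.mem_map.mp ha
  exact f.coeff_nonneg _

/-- `a_{g_j} b_α ≤ b_{g_j α}`: the weighted creation operators are bounded. -/
theorem coeff_mul_weight_le {n : ℕ} (f : PosRegular n) (m : ℕ) (j : Fin n)
    (α : FreeMonoid (Fin n)) :
    f.coeff (FreeMonoid.of j) * weight f m α ≤ weight f m (FreeMonoid.of j * α) := by
  have key : ∀ l : List (Fin n),
      f.coeff (FreeMonoid.of j) * (∑ c : Composition l.length,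
        ((l.splitWrtComposition c).map fun γ => f.coeff (FreeMonoid.ofList γ)).prod *
        ((c.length + m - 1).choose (m - 1) : ℝ)) ≤
      ∑ c : Composition (j :: l).length,
        (((j :: l).splitWrtComposition c).map fun γ => f.coeff (FreeMonoid.ofList γ)).prod *
        ((c.length + m - 1).choose (m - 1) : ℝ) := by
    intro l
    let e : Composition l.length → Composition (j :: l).length := fun c =>
      ⟨1 :: c.blocks, by
        intro i hi
        rcases List.mem_cons.mp hi with rfl | h
        · exact Nat.one_pos
        · exact c.blocks_pos h, by simp [c.blocks_sum, add_comm]⟩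
    have he : Function.Injective e := fun c d h => by
      have h' := congrArg Composition.blocks h
      exact Composition.ext (List.cons.inj h').2
    have hnn : ∀ c : Composition (j :: l).length,
        0 ≤ (((j :: l).splitWrtComposition c).map
          fun γ => f.coeff (FreeMonoid.ofList γ)).prod *
          ((c.length + m - 1).choose (m - 1) : ℝ) := fun c => by
      refine mul_nonneg (List.prod_nonneg ?_) (by positivity)
      intro a ha
      obtain ⟨γ, _, rfl⟩ := List.mem_map.mp ha
      exact f.coeff_nonneg _
    rw [Finset.mul_sum]
    calc _ ≤ ∑ c : Composition l.length,
          (((j :: l).splitWrtComposition (e c)).map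
            fun γ => f.coeff (FreeMonoid.ofList γ)).prod *
          (((e c).length + m - 1).choose (m - 1) : ℝ) := by
            refine Finset.sum_le_sum fun c _ => ?_
            have h1 : (j :: l).splitWrtComposition (e c) =
                [j] :: l.splitWrtComposition c := by
              simp [e, List.splitWrtComposition, List.splitWrtCompositionAux_cons]
            have h2 : (e c).length = c.length + 1 := by simp [e, Composition.length]
            rw [h1, h2, List.map_cons, List.prod_cons, ← mul_assoc]
            refine mul_le_mul_of_nonneg_left ?_ (mul_nonneg (f.coeff_nonneg _)
              (List.prod_nonneg ?_))
            · exact_mod_cast Nat.choose_le_choose _ (by omega)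
            · intro a ha
              obtain ⟨γ, _, rfl⟩ := List.mem_map.mp ha
              exact f.coeff_nonneg _
      _ = ∑ c ∈ Finset.univ.map ⟨e, he⟩,
          (((j :: l).splitWrtComposition c).map
            fun γ => f.coeff (FreeMonoid.ofList γ)).prod *
          ((c.length + m - 1).choose (m - 1) : ℝ) := by simp
      _ ≤ _ := Finset.sum_le_sum_of_subset_of_nonneg (Finset.subset_univ _)
          fun c _ _ => hnn c
  exact key _

/-! ### Tensor products of full Fock spaces and the universal model -/

variable {k : ℕ} {n : Fin k → ℕ}

/-- Tuples of words `(β₁, …, β_k)`, which index the orthonormal basis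
`e_{β₁} ⊗ ⋯ ⊗ e_{β_k}` of `F²(H_{n₁}) ⊗ ⋯ ⊗ F²(H_{n_k})`. -/
abbrev Words (n : Fin k → ℕ) : Type := ∀ i, FreeMonoid (Fin (n i))

/-- The Hilbert space `F²(H_{n₁}) ⊗ ⋯ ⊗ F²(H_{n_k}) ⊗ D`, as the square summable families of
vectors of `D` indexed by the orthonormal basis: `e_β ⊗ d` is `lp.single 2 β d`. -/
abbrev Fock (n : Fin k → ℕ) (D : Type v) [NormedAddCommGroup D] [InnerProductSpace ℂ D] :
    Type v := lp (fun _ : Words n => D) 2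

/-- Multiplication of the `i`-th word by the generator `g_j` on the left. -/
def consWord (i : Fin k) (j : Fin (n i)) (β : Words n) : Words n :=
  Function.update β i (FreeMonoid.of j * β i)

theorem consWord_injective (i : Fin k) (j : Fin (n i)) :
    Function.Injective (consWord (n := n) i j) := by
  intro β γ h
  funext l
  have hl := congrFun h l
  by_cases hli : l = i
  · subst hli
    simpa [consWord] using hl
  · simpa [consWord, hli] using hl

/-- The weight `√b_{β_i} / √b_{g_j β_i}` of the creation operator `W_{i,j}`. -/
def shiftWeight (f : ∀ i, PosRegular (n i)) (m : Fin k → ℕ) (i : Fin k) (j : Fin (n i))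
    (β : Words n) : ℝ :=
  √(weight (f i) (m i) (β i)) / √(weight (f i) (m i) (FreeMonoid.of j * β i))

theorem shiftWeight_nonneg (f : ∀ i, PosRegular (n i)) (m : Fin k → ℕ) (i : Fin k)
    (j : Fin (n i)) (β : Words n) : 0 ≤ shiftWeight f m i j β := by
  unfold shiftWeight; positivity

theorem shiftWeight_le (f : ∀ i, PosRegular (n i)) (m : Fin k → ℕ) (i : Fin k)
    (j : Fin (n i)) (β : Words n) :
    shiftWeight f m i j β ≤ 1 / √((f i).coeff (FreeMonoid.of j)) := by
  have ha := (f i).coeff_of_pos j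
  have h := coeff_mul_weight_le (f i) (m i) j (β i)
  have hs := Real.sqrt_le_sqrt h
  rw [Real.sqrt_mul ha.le] at hs
  have ha' := Real.sqrt_pos.mpr ha
  unfold shiftWeight
  rcases (Real.sqrt_nonneg (weight (f i) (m i) (FreeMonoid.of j * β i))).eq_or_lt with h0 | h0
  · rw [← h0, div_zero]; positivity
  · rw [div_le_div_iff₀ h0 ha']
    linarith

section Creation

variable {D : Type v} [NormedAddCommGroup D] [InnerProductSpace ℂ D]

/-- The coordinates of `(W_{i,j} ⊗ I_D) x`. -/
def creationFun (f : ∀ i, PosRegular (n i)) (m : Fin k → ℕ) (i : Fin k) (j : Fin (n i))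
    (x : Words n → D) : Words n → D :=
  Function.extend (consWord i j) (fun β => ((shiftWeight f m i j β : ℝ) : ℂ) • x β) 0

theorem creationFun_consWord (f : ∀ i, PosRegular (n i)) (m : Fin k → ℕ) (i : Fin k)
    (j : Fin (n i)) (x : Words n → D) (β : Words n) :
    creationFun f m i j x (consWord i j β) = ((shiftWeight f m i j β : ℝ) : ℂ) • x β :=
  (consWord_injective i j).extend_apply _ _ _

theorem creationFun_eq_zero (f : ∀ i, PosRegular (n i)) (m : Fin k → ℕ) (i : Fin k)
    (j : Fin (n i)) (x : Words n → D) {γ : Words n} (h : γ ∉ Set.range (consWord i j)) :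
    creationFun f m i j x γ = 0 := by
  unfold creationFun
  rw [Function.extend_apply' _ _ _ (fun ⟨a, ha⟩ => h ⟨a, ha⟩)]
  rfl

theorem creationFun_norm_sq_le (f : ∀ i, PosRegular (n i)) (m : Fin k → ℕ) (i : Fin k)
    (j : Fin (n i)) (x : Words n → D) (β : Words n) :
    ‖creationFun f m i j x (consWord i j β)‖ ^ (2 : ℝ≥0∞).toReal ≤
      (1 / √((f i).coeff (FreeMonoid.of j))) ^ 2 * ‖x β‖ ^ (2 : ℝ≥0∞).toReal := by
  rw [creationFun_consWord, norm_smul, Complex.norm_real, Real.norm_eq_abs,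
    abs_of_nonneg (shiftWeight_nonneg f m i j β)]
  simp only [ENNReal.toReal_ofNat, Real.rpow_ofNat]
  rw [mul_pow]
  exact mul_le_mul_of_nonneg_right (pow_le_pow_left₀ (shiftWeight_nonneg f m i j β)
    (shiftWeight_le f m i j β) 2) (by positivity)

theorem creationFun_zero_off (f : ∀ i, PosRegular (n i)) (m : Fin k → ℕ) (i : Fin k)
    (j : Fin (n i)) (x : Words n → D) (γ : Words n) (h : γ ∉ Set.range (consWord i j)) :
    ‖creationFun f m i j x γ‖ ^ (2 : ℝ≥0∞).toReal = 0 := by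
  rw [creationFun_eq_zero f m i j x h]; simp

theorem creationFun_memℓp (f : ∀ i, PosRegular (n i)) (m : Fin k → ℕ) (i : Fin k)
    (j : Fin (n i)) (x : Fock n D) :
    Memℓp (E := fun _ : Words n => D) (creationFun f m i j x) 2 := by
  apply memℓp_gen
  rw [← (consWord_injective i j).summable_iff (creationFun_zero_off f m i j x)]
  exact Summable.of_nonneg_of_le (fun _ => Real.rpow_nonneg (norm_nonneg _) _)
    (creationFun_norm_sq_le f m i j x)
    (((lp.memℓp x).summable (by norm_num)).mul_left _)

variable (D) in
/-- The operator `𝐖_{i,j} ⊗ I_D` on `F²(H_{n₁}) ⊗ ⋯ ⊗ F²(H_{n_k}) ⊗ D`, where `𝐖_{i,j}` is the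
weighted left creation operator `W_{i,j} e_α = √b_α / √b_{g_j α} e_{g_j α}` in the `i`-th factor;
see `universal_single`. -/
def universal (f : ∀ i, PosRegular (n i)) (m : Fin k → ℕ) (i : Fin k) (j : Fin (n i)) :
    Fock n D →L[ℂ] Fock n D :=
  LinearMap.mkContinuous
    { toFun := fun x => ⟨creationFun f m i j x, creationFun_memℓp f m i j x⟩
      map_add' := fun x y => by
        ext γ
        change creationFun f m i j (x + y : Fock n D) γ =
          creationFun f m i j x γ + creationFun f m i j y γ
        by_cases h : γ ∈ Set.range (consWord i j)
        · obtain ⟨β, rfl⟩ := h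
          simp only [creationFun_consWord, lp.coeFn_add, Pi.add_apply, smul_add]
        · simp only [creationFun_eq_zero f m i j _ h, add_zero]
      map_smul' := fun c x => by
        ext γ
        change creationFun f m i j (c • x : Fock n D) γ = c • creationFun f m i j x γ
        by_cases h : γ ∈ Set.range (consWord i j)
        · obtain ⟨β, rfl⟩ := h
          simp only [creationFun_consWord, lp.coeFn_smul, Pi.smul_apply]
          rw [smul_comm]
        · simp only [creationFun_eq_zero f m i j _ h, smul_zero] }
    (1 / √((f i).coeff (FreeMonoid.of j)))
    (fun x => by
      refine lp.norm_le_of_tsum_le (by norm_num) (by positivity) ?_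
      change ∑' γ, ‖creationFun f m i j x γ‖ ^ (2 : ℝ≥0∞).toReal ≤ _
      have hx := (lp.memℓp x).summable (p := 2) (by norm_num)
      have hsupp : Function.support
          (fun γ => ‖creationFun f m i j x γ‖ ^ (2 : ℝ≥0∞).toReal) ⊆
          Set.range (consWord i j) := fun γ hγ => by
        by_contra h
        exact hγ (creationFun_zero_off f m i j x γ h)
      rw [← (consWord_injective i j).tsum_eq hsupp,
        Real.mul_rpow (div_nonneg zero_le_one (Real.sqrt_nonneg _)) (norm_nonneg _), lp.norm_rpow_eq_tsum (by norm_num) x,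
        ← tsum_mul_left]
      refine Summable.tsum_le_tsum ?_ ?_ (hx.mul_left _)
      · intro β
        refine (creationFun_norm_sq_le f m i j x β).trans_eq ?_
        simp
      · refine Summable.of_nonneg_of_le (fun _ => by positivity)
          (creationFun_norm_sq_le f m i j x) (hx.mul_left _))

open Classical in
theorem universal_single (f : ∀ i, PosRegular (n i)) (m : Fin k → ℕ) (i : Fin k)
    (j : Fin (n i)) (β : Words n) (d : D) :
    universal D f m i j (lp.single 2 β d) =
      lp.single 2 (consWord i j β)
        (((√(weight (f i) (m i) (β i)) /
          √(weight (f i) (m i) (FreeMonoid.of j * β i)) : ℝ) : ℂ) • d) := by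
  ext γ
  change creationFun f m i j (lp.single 2 β d : Fock n D) γ = _
  by_cases h : γ ∈ Set.range (consWord i j)
  · obtain ⟨δ, rfl⟩ := h
    rw [creationFun_consWord]
    by_cases hδ : δ = β
    · subst hδ
      simp [shiftWeight]
    · rw [lp.single_apply_ne _ _ _ hδ,
        lp.single_apply_ne _ _ _ ((consWord_injective i j).ne hδ), smul_zero]
  · rw [creationFun_eq_zero f m i j _ h, lp.single_apply_ne]
    rintro rfl
    exact h ⟨β, rfl⟩

end Creation

/-! ### The noncommutative polydomain -/

section Domain

variable {H : Type u} [NormedAddCommGroup H] [InnerProductSpace ℂ H] [CompleteSpace H]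

/-- The elements of `B(H)^{n₁} × ⋯ × B(H)^{n_k}`. -/
abbrev OpTuple (n : Fin k → ℕ) (H : Type u) [NormedAddCommGroup H] [InnerProductSpace ℂ H] :
    Type u := ∀ i, Fin (n i) → (H →L[ℂ] H)

/-- `X_α = X_{j₁} ⋯ X_{j_p}` for the word `α = g_{j₁} ⋯ g_{j_p}`. -/
def wordOp {N : ℕ} (X : Fin N → (H →L[ℂ] H)) (α : FreeMonoid (Fin N)) : H →L[ℂ] H :=
  FreeMonoid.lift X α

/-- The term `a_α X_α Y X_α^*`, in `B(H)` with the weak operator topology. -/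
def phiTerm {N : ℕ} (f : PosRegular N) (X : Fin N → (H →L[ℂ] H)) (Y : H →L[ℂ] H)
    (α : FreeMonoid (Fin N)) : H →WOT[ℂ] H :=
  ContinuousLinearMapWOT.ofCLM
    ((f.coeff α : ℂ) • (wordOp X α ∘L Y ∘L ContinuousLinearMap.adjoint (wordOp X α)))

/-- `Φ_{f,X}(Y) = ∑_α a_α X_α Y X_α^*`, convergent in the weak operator topology. -/
def phi {N : ℕ} (f : PosRegular N) (X : Fin N → (H →L[ℂ] H)) (Y : H →L[ℂ] H) : H →L[ℂ] H :=
  (∑' α, phiTerm f X Y α).toCLM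

/-- `Δ_{f,X}^p(Y) = (id - Φ_{f₁,X₁})^{p₁} ∘ ⋯ ∘ (id - Φ_{f_k,X_k})^{p_k} (Y)`. -/
def defect (f : ∀ i, PosRegular (n i)) (X : OpTuple n H) (p : Fin k → ℕ) (Y : H →L[ℂ] H) :
    H →L[ℂ] H :=
  (List.finRange k).foldr (fun i Z => (fun Y' => Y' - phi (f i) (X i) Y')^[p i] Z) Y

/-- The noncommutative polydomain `D_f^m(H)`. -/
structure MemPolydomain (f : ∀ i, PosRegular (n i)) (m : Fin k → ℕ) (X : OpTuple n H) :
    Prop where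
  commute : ∀ p q, p ≠ q → ∀ a b, Commute (X p a) (X q b)
  summable : ∀ i, Summable (phiTerm (f i) (X i) 1)
  phi_le : ∀ i, phi (f i) (X i) 1 ≤ 1
  defect_nonneg : ∀ ε : Fin k → ℕ, (∀ i, ε i = 0 ∨ ε i = 1) →
    0 ≤ defect f X (fun i => ε i * m i) 1

/-- `(id - Φ_{f_k,X_k}^{q_k}) ∘ ⋯ ∘ (id - Φ_{f₁,X₁}^{q₁}) (I)`. -/
def pureNet (f : ∀ i, PosRegular (n i)) (X : OpTuple n H) (q : Fin k → ℕ) : H →L[ℂ] H :=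
  (List.finRange k).foldl (fun Z i => Z - (phi (f i) (X i))^[q i] Z) 1

/-- `(id - Φ_{f₁,X₁}^{q₁}) ∘ ⋯ ∘ (id - Φ_{f_k,X_k}^{q_k}) (I)`. -/
def cncNet (f : ∀ i, PosRegular (n i)) (X : OpTuple n H) (q : Fin k → ℕ) : H →L[ℂ] H :=
  (List.finRange k).foldr (fun i Z => Z - (phi (f i) (X i))^[q i] Z) 1

/-- Pure tuples: `lim_{q ∈ ℤ₊^k} (id - Φ_{f_k,X_k}^{q_k}) ⋯ (id - Φ_{f₁,X₁}^{q₁}) (I) = I`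
in the weak operator topology. -/
def IsPure (f : ∀ i, PosRegular (n i)) (X : OpTuple n H) : Prop :=
  Filter.Tendsto (fun q : Fin k → ℕ => ContinuousLinearMapWOT.ofCLM (pureNet f X q))
    Filter.atTop (nhds (ContinuousLinearMapWOT.ofCLM (1 : H →L[ℂ] H)))

/-- Completely non-coisometric tuples. -/
def IsCNC (f : ∀ i, PosRegular (n i)) (X : OpTuple n H) : Prop :=
  ¬ ∃ h : H, h ≠ 0 ∧ ∀ q : Fin k → ℕ, (∀ i, 1 ≤ q i) → inner ℂ (cncNet f X q h) h = 0

/-- The defect space: the closure of the range of `Δ_{f,X}^m(I)`. -/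
abbrev defectSpace (f : ∀ i, PosRegular (n i)) (m : Fin k → ℕ) (X : OpTuple n H) :
    Submodule ℂ H :=
  (LinearMap.range (defect f X m 1).toLinearMap).topologicalClosure

/-- The positive square root of a positive operator. -/
def opSqrt (A : H →L[ℂ] H) : H →L[ℂ] H := CFC.sqrt A

/-! ### The noncommutative Berezin kernel -/

/-- `K` is the noncommutative Berezin kernel of `X`:
`K h = ∑_β √b_{β₁} ⋯ √b_{β_k} e_β ⊗ Δ_{f,X}^m(I)^{1/2} X_{1,β₁}^* ⋯ X_{k,β_k}^* h`. -/
def IsBerezinKernel (f : ∀ i, PosRegular (n i)) (m : Fin k → ℕ) (X : OpTuple n H)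
    (K : H →L[ℂ] Fock n (defectSpace f m X)) : Prop :=
  ∀ (h : H) (β : Words n), ((K h β : defectSpace f m X) : H) =
    ((∏ i, √(weight (f i) (m i) (β i)) : ℝ) : ℂ) •
      opSqrt (defect f X m 1)
        (((List.finRange k).map
          fun i => ContinuousLinearMap.adjoint (wordOp (X i) (β i))).prod h)

open Classical in
/-- The noncommutative Berezin kernel `K_{f,X}`. It exists, and is unique, for every `X` in the
polydomain (elsewhere the value is `0` if there is none). -/
def berezinKernel (f : ∀ i, PosRegular (n i)) (m : Fin k → ℕ) (X : OpTuple n H) :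
    H →L[ℂ] Fock n (defectSpace f m X) :=
  if h : ∃ K, IsBerezinKernel f m X K then h.choose else 0

/-- The adjoint `K_{f,X}^*` of the Berezin kernel. -/
def berezinAdjoint (f : ∀ i, PosRegular (n i)) (m : Fin k → ℕ) (X : OpTuple n H) :
    Fock n (defectSpace f m X) →L[ℂ] H :=
  ContinuousLinearMap.adjoint (berezinKernel f m X)

/-! ### Multi-analytic operators and characteristic functions -/

/-- Multi-analytic operators with respect to the universal model. -/
def IsMultiAnalytic (f : ∀ i, PosRegular (n i)) (m : Fin k → ℕ)
    {E : Type u} [NormedAddCommGroup E] [InnerProductSpace ℂ E]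
    {G : Type v} [NormedAddCommGroup G] [InnerProductSpace ℂ G]
    (M : Fock n E →L[ℂ] Fock n G) : Prop :=
  ∀ i j, M ∘L universal E f m i j = universal G f m i j ∘L M

/-- Partial isometries: isometric on the orthogonal complement of the kernel. -/
def IsPartialIsometry {E : Type u} [NormedAddCommGroup E] [InnerProductSpace ℂ E]
    {G : Type v} [NormedAddCommGroup G] [InnerProductSpace ℂ G] (M : E →L[ℂ] G) : Prop :=
  ∀ x ∈ (LinearMap.ker M.toLinearMap)ᗮ, ‖M x‖ = ‖x‖

/-- Inner multi-analytic operators. -/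
def IsInner (f : ∀ i, PosRegular (n i)) (m : Fin k → ℕ)
    {E : Type u} [NormedAddCommGroup E] [InnerProductSpace ℂ E]
    {G : Type v} [NormedAddCommGroup G] [InnerProductSpace ℂ G]
    (M : Fock n E →L[ℂ] Fock n G) : Prop :=
  IsMultiAnalytic f m M ∧ IsPartialIsometry M

/-- The class `C_f^m(H)`: the tuples `X` in the polydomain which have a characteristic function,
that is, `K K^* + Ψ Ψ^* = I` for some multi-analytic operator `Ψ`, where `K` is the Berezin kernel
of `X`. -/
def HasCharFun (f : ∀ i, PosRegular (n i)) (m : Fin k → ℕ) (X : OpTuple n H) : Prop :=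
  MemPolydomain f m X ∧
  ∃ (E : Type u) (_ : NormedAddCommGroup E) (_ : InnerProductSpace ℂ E) (_ : CompleteSpace E)
    (Ψ : Fock n E →L[ℂ] Fock n (defectSpace f m X)),
    IsMultiAnalytic f m Ψ ∧
    berezinKernel f m X ∘L berezinAdjoint f m X +
      Ψ ∘L ContinuousLinearMap.adjoint Ψ = 1

/-- `I - K K^*`, where `K` is the Berezin kernel of `X`. -/
def kernelDefect (f : ∀ i, PosRegular (n i)) (m : Fin k → ℕ) (X : OpTuple n H) :
    Fock n (defectSpace f m X) →L[ℂ] Fock n (defectSpace f m X) :=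
  1 - berezinKernel f m X ∘L berezinAdjoint f m X

/-- The space `M_X`: the closure of the range of `I - K K^*`. -/
abbrev kernelDefectSpace (f : ∀ i, PosRegular (n i)) (m : Fin k → ℕ) (X : OpTuple n H) :
    Submodule ℂ (Fock n (defectSpace f m X)) :=
  (LinearMap.range (kernelDefect f m X).toLinearMap).topologicalClosure

/-- `A` is the operator `A_{i,j}` on `M_X` determined by
`A (I - K K^*)^{1/2} x = (I - K K^*)^{1/2} (𝐖_{i,j}^* ⊗ I) x` for all `x`. -/
def IsCompanionAdjoint (f : ∀ i, PosRegular (n i)) (m : Fin k → ℕ) (X : OpTuple n H)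
    (i : Fin k) (j : Fin (n i))
    (A : kernelDefectSpace f m X →L[ℂ] kernelDefectSpace f m X) : Prop :=
  ∀ (x : Fock n (defectSpace f m X)) (y : kernelDefectSpace f m X),
    (y : Fock n (defectSpace f m X)) = opSqrt (kernelDefect f m X) x →
    (A y : Fock n (defectSpace f m X)) =
      opSqrt (kernelDefect f m X)
        (ContinuousLinearMap.adjoint (universal (defectSpace f m X) f m i j) x)

open Classical in
/-- The operators `A_{i,j}` (with value `0` if there is no such operator, which does not happen
for tuples with a characteristic function). -/
def companionAdjoint (f : ∀ i, PosRegular (n i)) (m : Fin k → ℕ) (X : OpTuple n H)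
    (i : Fin k) (j : Fin (n i)) : kernelDefectSpace f m X →L[ℂ] kernelDefectSpace f m X :=
  if h : ∃ A, IsCompanionAdjoint f m X i j A then h.choose else 0

/-- The tuple `M_X = (A_{i,j}^*)` on the space `M_X`. -/
def companion (f : ∀ i, PosRegular (n i)) (m : Fin k → ℕ) (X : OpTuple n H) :
    OpTuple n (kernelDefectSpace f m X) :=
  fun i j => ContinuousLinearMap.adjoint (companionAdjoint f m X i j)

/-- The characteristic function `Θ_{f,X} = (I - K_{f,X} K_{f,X}^*)^{1/2} K_{f,M_X}^*`. -/
def charFun (f : ∀ i, PosRegular (n i)) (m : Fin k → ℕ) (X : OpTuple n H) :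
    Fock n (defectSpace f m (companion f m X)) →L[ℂ] Fock n (defectSpace f m X) :=
  opSqrt (kernelDefect f m X) ∘L (kernelDefectSpace f m X).subtypeL ∘L
    berezinAdjoint f m (companion f m X)

/-! ### The operator model -/

/-- The model space: the orthogonal complement of the range of `Θ_{f,X}`. -/
abbrev modelSpace (f : ∀ i, PosRegular (n i)) (m : Fin k → ℕ) (X : OpTuple n H) :
    Submodule ℂ (Fock n (defectSpace f m X)) :=
  (LinearMap.range (charFun f m X).toLinearMap)ᗮ

/-- The compressions `G_{i,j}` of `𝐖_{i,j} ⊗ I` to the model space. -/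
def modelTuple (f : ∀ i, PosRegular (n i)) (m : Fin k → ℕ) (X : OpTuple n H) :
    OpTuple n (modelSpace f m X) :=
  fun i j => (modelSpace f m X).orthogonalProjectionOnto ∘L
    universal (defectSpace f m X) f m i j ∘L (modelSpace f m X).subtypeL

/-- Unitary equivalence of tuples: `X_{i,j} = U^* X'_{i,j} U` for a unitary operator `U`. -/
def UnitarilyEquivalent {H' : Type v} [NormedAddCommGroup H'] [InnerProductSpace ℂ H']
    (X : OpTuple n H) (X' : OpTuple n H') : Prop :=
  ∃ U : H ≃ₗᵢ[ℂ] H', ∀ i j h, X i j h = U.symm (X' i j (U h))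

end Domain

end Polydomain

end

open Polydomain

set_option linter.unusedSectionVars false

/-! ### Weights, and the maps `Φ` acting on quadratic forms with values in `[0, ∞]`. -/

namespace Polydomain

section Forms

/-! Let K be the Berezin kernel of T and Y = I - K K^*. Two facts carry the theorem: K^*K is the
limit of the net that defines purity, and Y = Θ Θ^* with Θ multi-analytic.

For the first fact, a positive operator A is replaced by its form h ↦ ⟨h, A h⟩ with values in [0,
∞], where series may be rearranged freely. The weight b_{i,α} collects the factorizations of α with
the coefficients of (1 - x)^{-m_i}, so q ↦ ∑_α b_{i,α} q(X_{i,α}^* ·) is the m_i-th power of the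
geometric series ∑_p Φ_i^p (`weightForm_eq`). Applied to the form of the defect Δ^m(I), one index i
at a time, it undoes each factor (1 - Φ_i)^{m_i}, leaving the limit of 1 - Φ_i^M
(`geomForm_iterate_form`, `listWeightForm_listDefect`). Hence ‖K h‖² is the supremum over q of the
forms of `pureNet f X q` at h (`ofReal_norm_berezinKernel_sq`). So T is pure iff K is isometric
(`isPure_iff`), and K is injective if T is completely non-coisometric (`injective_of_isCNC`).

For the second fact, the factorization Y = Ψ Ψ^* gives an isometry C on M_T with C Y^{1/2} = Ψ^*,
and C intertwines A_{i,j} with W_{i,j}^* ⊗ I. Thus M_T is the compression of a universal model to a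
coinvariant subspace (`exists_companion_dilation`). The defect of the universal model is the
projection onto the vacuum vectors, and its Berezin sum is Parseval's identity. Compressing, the
Berezin kernel J of M_T is isometric and intertwining (`berezinKernel_of_universal_compression`). So
Θ = Y^{1/2} J^* is multi-analytic and Θ Θ^* = Y^{1/2} J^*J Y^{1/2} = Y.

The rest is Hilbert space geometry from K K^* + Θ Θ^* = I. If K is isometric, then Θ Θ^* is the
projection onto the complement of the range of K. Hence Θ is a partial isometry and K is a unitary
onto the model space; since K T_{i,j}^* = (W_{i,j}^* ⊗ I) K, it carries T to the compressions.
Conversely, if Θ is a partial isometry, then K K^* is a projection, and an injective K is then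
isometric. -/

theorem tsum_list {ι : Type*} (G : List ι → ℝ≥0∞) :
    ∑' L, G L = G [] + ∑' x, ∑' L, G (x :: L) := by
  let e : Option (ι × List ι) ≃ List ι :=
    { toFun := fun o => o.elim [] fun p => p.1 :: p.2
      invFun := fun L => match L with
        | [] => none
        | x :: L => some (x, L)
      left_inv := fun o => by rcases o with _ | ⟨x, L⟩ <;> rfl
      right_inv := fun L => by cases L <;> rfl }
  rw [← e.tsum_eq, ENNReal.tsum_eq_add_tsum_ite none]
  congr 1
  rw [← ENNReal.tsum_prod (f := fun x L => G (x :: L)),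
    ← (Option.some_injective (ι × List ι)).tsum_eq ?_]
  · refine tsum_congr fun p => ?_
    simp [e]
  · intro o ho
    rcases o with _ | p
    · simp at ho
    · exact ⟨p, rfl⟩

/-- The weight of a word as a sum over the factorizations of the word into arbitrary words. -/
theorem ofReal_weight {N : ℕ} (f : PosRegular N) (m : ℕ) (α : FreeMonoid (Fin N)) :
    ENNReal.ofReal (weight f m α) = ∑' L : List (FreeMonoid (Fin N)),
      open Classical in if L.prod = α then ENNReal.ofReal (L.map f.coeff).prod *
        ((L.length + m - 1).choose (m - 1) : ℝ≥0∞) else 0 := by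
  classical
  have hnn : ∀ L : List (FreeMonoid (Fin N)), 0 ≤ (L.map f.coeff).prod := fun L => by
    refine List.prod_nonneg fun a ha => ?_
    obtain ⟨γ, _, rfl⟩ := List.mem_map.mp ha
    exact f.coeff_nonneg _
  let e : Composition (FreeMonoid.toList α).length → List (FreeMonoid (Fin N)) := fun c =>
    ((FreeMonoid.toList α).splitWrtComposition c).map FreeMonoid.ofList
  have hlen : ∀ c, (e c).map (fun w => (FreeMonoid.toList w).length) = c.blocks := fun c => by
    rw [← List.map_length_splitWrtComposition (FreeMonoid.toList α) c]
    simp only [e, List.map_map]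
    rfl
  have he : Function.Injective e := fun c d h => by
    refine Composition.ext ?_
    rw [← hlen c, ← hlen d, h]
  have hprod : ∀ c, (e c).prod = α := fun c => by
    simp only [e]
    rw [← FreeMonoid.ofList_flatten, List.flatten_splitWrtComposition]
    rfl
  have hl : ∀ c, (e c).length = c.length := fun c => by
    simp [e, List.length_splitWrtComposition]
  rw [weight, ENNReal.ofReal_sum_of_nonneg, ← tsum_fintype (L := .unconditional _)]
  · rw [← he.tsum_eq]
    · refine tsum_congr fun c => ?_
      rw [if_pos (hprod c), hl, ENNReal.ofReal_mul, ENNReal.ofReal_natCast]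
      · simp [e, List.map_map, Function.comp_def]
      · have := hnn (e c)
        simpa [e, List.map_map, Function.comp_def] using this
    · intro L hL
      simp only [Function.mem_support, ne_eq, ite_eq_right_iff, Classical.not_imp] at hL
      obtain ⟨rfl, hL⟩ := hL
      -- The coefficient of the empty word is zero, so a list with a nonzero term has no empty
      -- factor and its lengths form a composition.
      have hne : ∀ w ∈ L, w ≠ 1 := by
        rintro w hw rfl
        apply hL
        rw [List.prod_eq_zero, ENNReal.ofReal_zero, zero_mul]
        exact List.mem_map.mpr ⟨1, hw, f.coeff_one⟩
      have hflat : FreeMonoid.toList L.prod = (L.map FreeMonoid.toList).flatten := by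
        rw [FreeMonoid.toList_prod]
      refine ⟨⟨L.map fun w => (FreeMonoid.toList w).length, ?_, ?_⟩, ?_⟩
      · intro i hi
        obtain ⟨w, hw, rfl⟩ := List.mem_map.mp hi
        exact List.length_pos_iff.mpr fun h => hne w hw (FreeMonoid.toList.injective h)
      · rw [hflat, List.length_flatten, List.map_map]
        rfl
      -- The type of compositions depends on the word. Stating the claim for a variable `l` allows
      -- the word to be replaced by the concatenation of its factors.
      · have key : ∀ (l : List (Fin N)) (L' : List (List (Fin N))), l = L'.flatten →
            ∀ c : Composition l.length, c.blocks = L'.map List.length →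
              l.splitWrtComposition c = L' := by
          rintro l L' rfl c hc
          exact List.splitWrtComposition_flatten L' c hc.symm
        have := key _ _ hflat ⟨L.map fun w => (FreeMonoid.toList w).length, by
          intro i hi
          obtain ⟨w, hw, rfl⟩ := List.mem_map.mp hi
          exact List.length_pos_iff.mpr fun h => hne w hw (FreeMonoid.toList.injective h), by
          rw [hflat, List.length_flatten, List.map_map]
          rfl⟩ (List.map_map (l := L) (f := FreeMonoid.toList) (g := List.length)).symm
        simp only [e]
        rw [this, List.map_map]
        simp
  · intro c _
    refine mul_nonneg ?_ (by positivity)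
    have := hnn (e c)
    simpa [e, List.map_map, Function.comp_def] using this

/-- Every word splits into letters, whose coefficients are positive. Hence the quotients defining
the creation operators and the rescaled coordinates below have nonzero denominators. -/
theorem weight_pos {N : ℕ} (f : PosRegular N) (m : ℕ) (α : FreeMonoid (Fin N)) :
    0 < weight f m α := by
  induction α using FreeMonoid.inductionOn' with
  | one => rw [weight_one]; exact one_pos
  | of_mul a α ih =>
    exact (mul_pos (f.coeff_of_pos a) ih).trans_le (coeff_mul_weight_le f m a α)

variable {H : Type*} [NormedAddCommGroup H] [InnerProductSpace ℂ H] [CompleteSpace H]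
variable {N : ℕ}

/-- The action of `Φ_{f,X}` on forms: `q ↦ ∑_α a_α q(X_α^* ·)`. -/
noncomputable def phiForm (f : PosRegular N) (X : Fin N → (H →L[ℂ] H)) (q : H → ℝ≥0∞) (h : H) :
    ℝ≥0∞ :=
  ∑' α, ENNReal.ofReal (f.coeff α) * q (ContinuousLinearMap.adjoint (wordOp X α) h)

/-- The geometric series `∑_p Φ_{f,X}^p` acting on forms. -/
noncomputable def geomForm (f : PosRegular N) (X : Fin N → (H →L[ℂ] H)) (q : H → ℝ≥0∞) (h : H) :
    ℝ≥0∞ :=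
  ∑' p : ℕ, (phiForm f X)^[p] q h

/-- The map `q ↦ ∑_α b_α q(X_α^* ·)` on forms. -/
noncomputable def weightForm (f : PosRegular N) (m : ℕ) (X : Fin N → (H →L[ℂ] H))
    (q : H → ℝ≥0∞) (h : H) : ℝ≥0∞ :=
  ∑' α, ENNReal.ofReal (weight f m α) * q (ContinuousLinearMap.adjoint (wordOp X α) h)

theorem adjoint_wordOp_mul (X : Fin N → (H →L[ℂ] H)) (α β : FreeMonoid (Fin N)) (h : H) :
    ContinuousLinearMap.adjoint (wordOp X (α * β)) h =
      ContinuousLinearMap.adjoint (wordOp X β) (ContinuousLinearMap.adjoint (wordOp X α) h) := by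
  simp only [wordOp, map_mul]
  rw [ContinuousLinearMap.mul_def, ContinuousLinearMap.adjoint_comp]
  rfl

theorem adjoint_wordOp_one (X : Fin N → (H →L[ℂ] H)) (h : H) :
    ContinuousLinearMap.adjoint (wordOp X 1) h = h := by
  simp only [wordOp, map_one]
  rw [ContinuousLinearMap.one_def, ContinuousLinearMap.adjoint_id]
  rfl

theorem phiForm_tsum {ι : Type*} (f : PosRegular N) (X : Fin N → (H →L[ℂ] H)) (c : ι → ℝ≥0∞)
    (q : ι → H → ℝ≥0∞) :
    phiForm f X (fun h => ∑' j, c j * q j h) = fun h => ∑' j, c j * phiForm f X (q j) h := by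
  funext h
  simp only [phiForm, ← ENNReal.tsum_mul_left]
  rw [ENNReal.tsum_comm]
  exact tsum_congr fun j => tsum_congr fun α => by ring

theorem phiForm_iterate_tsum {ι : Type*} (f : PosRegular N) (X : Fin N → (H →L[ℂ] H))
    (c : ι → ℝ≥0∞) (q : ι → H → ℝ≥0∞) (p : ℕ) :
    (phiForm f X)^[p] (fun h => ∑' j, c j * q j h) =
      fun h => ∑' j, c j * (phiForm f X)^[p] (q j) h := by
  induction p with
  | zero => rfl
  | succ p ih => simp only [Function.iterate_succ_apply', ih, phiForm_tsum]

/-- The resolvent equation R = 1 + Φ R for R = ∑ Φ^p. It is what later allows the geometric series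
to be inverted. -/
theorem geomForm_eq (f : PosRegular N) (X : Fin N → (H →L[ℂ] H)) (q : H → ℝ≥0∞) (h : H) :
    geomForm f X q h = q h + phiForm f X (geomForm f X q) h := by
  have h1 := phiForm_tsum f X (fun _ : ℕ => 1) (fun p => (phiForm f X)^[p] q)
  simp only [one_mul] at h1
  have h2 : phiForm f X (geomForm f X q) h = ∑' p, (phiForm f X)^[p + 1] q h := by
    simp only [Function.iterate_succ_apply']
    exact congrFun h1 h
  rw [h2, geomForm, tsum_eq_zero_add' ENNReal.summable]
  rfl

theorem phiForm_iterate (f : PosRegular N) (X : Fin N → (H →L[ℂ] H)) (q : H → ℝ≥0∞) (p : ℕ)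
    (h : H) : (phiForm f X)^[p] q h = ∑' L : List (FreeMonoid (Fin N)),
      if L.length = p then ENNReal.ofReal (L.map f.coeff).prod *
        q (ContinuousLinearMap.adjoint (wordOp X L.prod) h) else 0 := by
  induction p generalizing h with
  | zero =>
    rw [tsum_list]
    simp [adjoint_wordOp_one]
  | succ p ih =>
    rw [tsum_list, Function.iterate_succ_apply', phiForm]
    simp only [ih, List.length_nil, List.length_cons, add_left_inj, List.map_cons, List.prod_cons,
      adjoint_wordOp_mul, ENNReal.ofReal_mul (f.coeff_nonneg _), ← ENNReal.tsum_mul_left,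
      mul_ite, mul_zero, mul_assoc]
    simp

/-- Both sides are one sum over lists of words: grouping by the product of the list gives the
weights, grouping by its length gives the powers of Φ. -/
theorem weightForm_eq_tsum (f : PosRegular N) (m : ℕ) (X : Fin N → (H →L[ℂ] H))
    (q : H → ℝ≥0∞) (h : H) :
    weightForm f m X q h =
      ∑' p : ℕ, ((p + m - 1).choose (m - 1) : ℝ≥0∞) * (phiForm f X)^[p] q h := by
  classical
  have h1 : weightForm f m X q h = ∑' L : List (FreeMonoid (Fin N)),
      ENNReal.ofReal (L.map f.coeff).prod * ((L.length + m - 1).choose (m - 1) : ℝ≥0∞) *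
        q (ContinuousLinearMap.adjoint (wordOp X L.prod) h) := by
    simp only [weightForm, ofReal_weight, ← ENNReal.tsum_mul_right, ite_mul, zero_mul]
    rw [ENNReal.tsum_comm]
    refine tsum_congr fun L => ?_
    rw [tsum_eq_single L.prod fun α hα => if_neg hα.symm, if_pos rfl]
  rw [h1]
  simp only [phiForm_iterate, ← ENNReal.tsum_mul_left]
  rw [ENNReal.tsum_comm]
  refine tsum_congr fun L => ?_
  rw [tsum_eq_single L.length fun p hp => by rw [if_neg hp.symm, mul_zero], if_pos rfl]
  ring

/-- Cauchy product with the geometric series. The coefficients add up by the hockey-stick identity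
∑_{j ≤ p} C(j+m, m) = C(p+m+1, m+1). -/
theorem geomForm_iterate (f : PosRegular N) (m : ℕ) (X : Fin N → (H →L[ℂ] H))
    (q : H → ℝ≥0∞) :
    (geomForm f X)^[m + 1] q =
      fun h => ∑' p : ℕ, ((p + m).choose m : ℝ≥0∞) * (phiForm f X)^[p] q h := by
  induction m with
  | zero => funext h; simp [geomForm]
  | succ m ih =>
    funext h
    rw [Function.iterate_succ_apply', ih]
    simp only [geomForm, phiForm_iterate_tsum, ← Function.iterate_add_apply]
    rw [← ENNReal.tsum_prod (f := fun r p => ((p + m).choose m : ℝ≥0∞) * (phiForm f X)^[r + p] q h),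
      ← Finset.HasAntidiagonal.sigmaAntidiagonalEquivProd.tsum_eq, ENNReal.tsum_sigma']
    refine tsum_congr fun p => ?_
    refine (Finset.tsum_subtype _ fun x : ℕ × ℕ =>
      ((x.2 + m).choose m : ℝ≥0∞) * (phiForm f X)^[x.1 + x.2] q h).trans ?_
    rw [Finset.sum_congr rfl fun x hx => by
      rw [Finset.HasAntidiagonal.mem_antidiagonal.mp hx], ← Finset.sum_mul]
    congr 1
    rw [Finset.Nat.sum_antidiagonal_eq_sum_range_succ (fun _ j => ((j + m).choose m : ℝ≥0∞)),
      Finset.sum_flip (fun j => ((j + m).choose m : ℝ≥0∞)), ← Nat.cast_sum,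
      Nat.sum_range_add_choose]
    rfl

/-- The expansion of (1 - x)^{-m} evaluated at Φ. For `m = 0` it fails, since truncated subtraction
makes every binomial coefficient in the weight equal to 1. -/
theorem weightForm_eq (f : PosRegular N) {m : ℕ} (hm : 1 ≤ m) (X : Fin N → (H →L[ℂ] H)) :
    weightForm f m X = (geomForm f X)^[m] := by
  obtain ⟨m, rfl⟩ := Nat.exists_eq_add_of_le' hm
  funext q h
  rw [geomForm_iterate, weightForm_eq_tsum]
  rfl

end Forms

end Polydomain

/-! ### Column operators, forms of positive operators, and `Φ` as a linear map on `B(H)`. -/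

namespace Polydomain

section Columns

variable {H : Type*} [NormedAddCommGroup H] [InnerProductSpace ℂ H]
variable {G : Type*} [NormedAddCommGroup G] [InnerProductSpace ℂ G]

theorem ofReal_norm_sq_eq_tsum {ι : Type*} (x : lp (fun _ : ι => G) 2) :
    ENNReal.ofReal (‖x‖ ^ 2) = ∑' i, ENNReal.ofReal (‖x i‖ ^ 2) := by
  have h := lp.norm_rpow_eq_tsum (p := 2) (by norm_num) x
  have hs := (lp.memℓp x).summable (p := 2) (by norm_num)
  simp only [ENNReal.toReal_ofNat, Real.rpow_ofNat] at h hs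
  rw [h, ENNReal.ofReal_tsum_of_nonneg (fun _ => by positivity) hs]

/-- A square summable family of operators defines a column operator. -/
theorem exists_column {ι : Type*} (B : ι → H →L[ℂ] G) {C : ℝ} (hC : 0 ≤ C)
    (hB : ∀ h, ∑' i, ENNReal.ofReal (‖B i h‖ ^ 2) ≤ ENNReal.ofReal (C * ‖h‖ ^ 2)) :
    ∃ V : H →L[ℂ] lp (fun _ : ι => G) 2, ∀ h i, V h i = B i h := by
  have hs : ∀ h, Summable fun i => ‖B i h‖ ^ 2 := fun h => by
    have := ENNReal.summable_toReal (ne_top_of_le_ne_top ENNReal.ofReal_ne_top (hB h))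
    simpa only [ENNReal.toReal_ofReal (sq_nonneg _)] using this
  have hmem : ∀ h, Memℓp (E := fun _ : ι => G) (fun i => B i h) 2 := fun h =>
    memℓp_gen (by simpa using hs h)
  refine ⟨LinearMap.mkContinuous
    { toFun := fun h => ⟨fun i => B i h, hmem h⟩
      map_add' := fun x y => by ext i; exact map_add (B i) x y
      map_smul' := fun c x => by ext i; exact map_smul (B i) c x } (√C) fun h => ?_,
    fun h i => rfl⟩
  have h1 : ‖(⟨fun i => B i h, hmem h⟩ : lp (fun _ : ι => G) 2)‖ ^ 2 ≤ C * ‖h‖ ^ 2 := by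
    rw [← ENNReal.ofReal_le_ofReal_iff (by positivity), ofReal_norm_sq_eq_tsum]
    exact hB h
  refine (Real.le_sqrt (norm_nonneg _) (by positivity)).mpr h1 |>.trans_eq ?_
  rw [Real.sqrt_mul hC, Real.sqrt_sq (norm_nonneg _)]

end Columns

variable {H : Type*} [NormedAddCommGroup H] [InnerProductSpace ℂ H] [CompleteSpace H]

theorem nonneg_of_inner {A : H →L[ℂ] H} (h : ∀ x, ∃ r : ℝ, 0 ≤ r ∧ inner ℂ x (A x) = (r : ℂ)) :
    0 ≤ A := by
  rw [ContinuousLinearMap.nonneg_iff_isPositive, ContinuousLinearMap.isPositive_iff_complex]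
  intro x
  obtain ⟨r, hr, hx⟩ := h x
  have : inner ℂ (A x) x = (r : ℂ) := by
    rw [← inner_conj_symm, hx, Complex.conj_ofReal]
  rw [this]
  exact ⟨by simp, by simpa using hr⟩

theorem re_inner_nonneg {A : H →L[ℂ] H} (hA : 0 ≤ A) (x : H) :
    0 ≤ RCLike.re (inner ℂ x (A x)) :=
  ((ContinuousLinearMap.nonneg_iff_isPositive A).mp hA).re_inner_nonneg_right x

theorem inner_eq_re {A : H →L[ℂ] H} (hA : IsSelfAdjoint A) (x : H) :
    inner ℂ x (A x) = ((RCLike.re (inner ℂ x (A x)) : ℝ) : ℂ) := by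
  have h : (starRingEnd ℂ) (inner ℂ x (A x)) = inner ℂ x (A x) := by
    rw [inner_conj_symm]
    exact ContinuousLinearMap.isSelfAdjoint_iff_isSymmetric.mp hA x x
  exact (RCLike.conj_eq_iff_re.mp h).symm

theorem nonneg_of_re_inner {A : H →L[ℂ] H} (hA : IsSelfAdjoint A)
    (h : ∀ x, 0 ≤ RCLike.re (inner ℂ x (A x))) : 0 ≤ A :=
  nonneg_of_inner fun x => ⟨_, h x, inner_eq_re hA x⟩

/-- The form `h ↦ ⟨h, A h⟩` of a positive operator. -/
noncomputable def form (A : H →L[ℂ] H) (h : H) : ℝ≥0∞ :=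
  ENNReal.ofReal (RCLike.re (inner ℂ h (A h)))

theorem form_one : form (1 : H →L[ℂ] H) = fun h => ENNReal.ofReal (‖h‖ ^ 2) := by
  funext h
  rw [form, one_apply_eq_self, inner_self_eq_norm_sq]

theorem form_add {A B : H →L[ℂ] H} (hA : 0 ≤ A) (hB : 0 ≤ B) (h : H) :
    form (A + B) h = form A h + form B h := by
  rw [form, add_apply, inner_add_right, map_add,
    ENNReal.ofReal_add (re_inner_nonneg hA h) (re_inner_nonneg hB h)]
  rfl

theorem form_mono {A B : H →L[ℂ] H} (hAB : A ≤ B) (h : H) : form A h ≤ form B h := by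
  refine ENNReal.ofReal_le_ofReal ?_
  have := re_inner_nonneg (sub_nonneg.mpr hAB) h
  rw [sub_apply, inner_sub_right, map_sub] at this
  linarith

/-- Positivity is essential: `form` truncates negative values to 0, so it determines only positive
operators. -/
theorem eq_of_form_eq {A B : H →L[ℂ] H} (hA : 0 ≤ A) (hB : 0 ≤ B) (h : form A = form B) :
    A = B := by
  have h0 : A.toLinearMap = B.toLinearMap := by
    rw [← ext_inner_map]
    intro x
    have h1 := congrFun h x
    rw [form, form, ENNReal.ofReal_eq_ofReal_iff (re_inner_nonneg hA x) (re_inner_nonneg hB x)]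
      at h1
    have h2 := inner_eq_re (IsSelfAdjoint.of_nonneg hA) x
    have h3 := inner_eq_re (IsSelfAdjoint.of_nonneg hB) x
    rw [← h1, ← h2] at h3
    rw [← inner_conj_symm, ← inner_conj_symm (B.toLinearMap x)]
    exact congrArg _ h3.symm
  exact ContinuousLinearMap.coe_injective h0

section Phi

variable {N : ℕ} {f : PosRegular N} {X : Fin N → (H →L[ℂ] H)}

theorem inner_phiTerm (Y : H →L[ℂ] H) (α : FreeMonoid (Fin N)) (u v : H) :
    inner ℂ u (phiTerm f X Y α v) = (f.coeff α : ℂ) *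
      inner ℂ (ContinuousLinearMap.adjoint (wordOp X α) u)
        (Y (ContinuousLinearMap.adjoint (wordOp X α) v)) := by
  have : phiTerm f X Y α v =
      (f.coeff α : ℂ) • wordOp X α (Y (ContinuousLinearMap.adjoint (wordOp X α) v)) := rfl
  rw [this, inner_smul_right, ContinuousLinearMap.adjoint_inner_left]

theorem hasSum_wot_iff {ι : Type*} {t : ι → H →WOT[ℂ] H} {Z : H →WOT[ℂ] H} :
    HasSum t Z ↔ ∀ u v, HasSum (fun i => inner ℂ u (t i v)) (inner ℂ u (Z v)) := by
  have h : ∀ (s : Finset ι) (v : H), (∑ i ∈ s, t i) v = ∑ i ∈ s, t i v := fun s v => by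
    classical
    induction s using Finset.induction_on with
    | empty => simp
    | insert a s ha ih => simp [Finset.sum_insert ha, ih]
  rw [HasSum, ContinuousLinearMapWOT.tendsto_iff_forall_inner_apply_tendsto, forall_comm]
  simp only [h, inner_sum]
  rfl

/-- The series is V^*V' for the two bounded columns V = (√a_α X_α^*) and V' = (√a_α Y X_α^*). Its
matrix coefficients are thus inner products of square summable families, with no positivity of `Y`
needed. -/
theorem summable_phiTerm_of_bound {C : ℝ} (hC : 0 ≤ C)
    (hb : ∀ h, phiForm f X (form 1) h ≤ ENNReal.ofReal (C * ‖h‖ ^ 2)) (Y : H →L[ℂ] H) :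
    Summable (phiTerm f X Y) := by
  let B : FreeMonoid (Fin N) → H →L[ℂ] H := fun α =>
    ((√(f.coeff α) : ℝ) : ℂ) • ContinuousLinearMap.adjoint (wordOp X α)
  have hB : ∀ α h, ‖B α h‖ ^ 2 =
      f.coeff α * ‖ContinuousLinearMap.adjoint (wordOp X α) h‖ ^ 2 := fun α h => by
    change ‖((√(f.coeff α) : ℝ) : ℂ) • ContinuousLinearMap.adjoint (wordOp X α) h‖ ^ 2 = _
    rw [norm_smul, mul_pow, Complex.norm_real, Real.norm_eq_abs, sq_abs,
      Real.sq_sqrt (f.coeff_nonneg α)]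
  have hb' : ∀ h, ∑' α, ENNReal.ofReal (‖B α h‖ ^ 2) ≤ ENNReal.ofReal (C * ‖h‖ ^ 2) := fun h => by
    refine le_trans (le_of_eq ?_) (hb h)
    simp only [hB, phiForm, form_one, ENNReal.ofReal_mul (f.coeff_nonneg _)]
  obtain ⟨V, hV⟩ := exists_column B hC hb'
  have hb'' : ∀ h, ∑' α, ENNReal.ofReal (‖(Y ∘L B α) h‖ ^ 2) ≤
      ENNReal.ofReal (‖Y‖ ^ 2 * C * ‖h‖ ^ 2) := fun h => by
    rw [mul_assoc, ENNReal.ofReal_mul (by positivity)]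
    refine le_trans ?_ (mul_le_mul_right (hb' h) _)
    rw [← ENNReal.tsum_mul_left]
    refine ENNReal.tsum_le_tsum fun α => ?_
    rw [← ENNReal.ofReal_mul (by positivity), ← mul_pow]
    exact ENNReal.ofReal_le_ofReal (pow_le_pow_left₀ (norm_nonneg _) (Y.le_opNorm _) 2)
  obtain ⟨V', hV'⟩ := exists_column (fun α => Y ∘L B α) (by positivity) hb''
  refine ⟨ContinuousLinearMapWOT.ofCLM (ContinuousLinearMap.adjoint V ∘L V'),
    hasSum_wot_iff.mpr fun u v => ?_⟩
  have h1 := lp.hasSum_inner (𝕜 := ℂ) (V u) (V' v)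
  have h2 : inner ℂ u ((ContinuousLinearMapWOT.ofCLM (ContinuousLinearMap.adjoint V ∘L V') :
      H →WOT[ℂ] H) v) = inner ℂ (V u) (V' v) :=
    ContinuousLinearMap.adjoint_inner_right V u (V' v)
  rw [h2]
  have h3 : (fun α => inner ℂ u (phiTerm f X Y α v)) = fun α => inner ℂ (V u α) (V' v α) := by
    funext α
    rw [inner_phiTerm, hV, hV']
    change _ = inner ℂ (((√(f.coeff α) : ℝ) : ℂ) • ContinuousLinearMap.adjoint (wordOp X α) u)
      (Y (((√(f.coeff α) : ℝ) : ℂ) • ContinuousLinearMap.adjoint (wordOp X α) v))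
    rw [map_smul, inner_smul_left, inner_smul_right, Complex.conj_ofReal, ← mul_assoc,
      ← Complex.ofReal_mul, Real.mul_self_sqrt (f.coeff_nonneg α)]
  exact h3 ▸ h1

theorem hasSum_inner_phi {Y : H →L[ℂ] H} (hX : Summable (phiTerm f X Y)) (u v : H) :
    HasSum (fun α => (f.coeff α : ℂ) * inner ℂ (ContinuousLinearMap.adjoint (wordOp X α) u)
      (Y (ContinuousLinearMap.adjoint (wordOp X α) v))) (inner ℂ u (phi f X Y v)) := by
  have h := hasSum_wot_iff.mp hX.hasSum u v
  simp only [inner_phiTerm] at h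
  exact h

theorem hasSum_re_inner_phi {Y : H →L[ℂ] H} (hX : Summable (phiTerm f X Y)) (u : H) :
    HasSum (fun α => f.coeff α * RCLike.re (inner ℂ (ContinuousLinearMap.adjoint (wordOp X α) u)
      (Y (ContinuousLinearMap.adjoint (wordOp X α) u)))) (RCLike.re (inner ℂ u (phi f X Y u))) := by
  have h := Complex.reCLM.hasSum (hasSum_inner_phi hX u u)
  simpa [Function.comp_def] using h

theorem phi_nonneg_of_summable {Y : H →L[ℂ] H} (hX : Summable (phiTerm f X Y)) (hY : 0 ≤ Y) :
    0 ≤ phi f X Y := by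
  refine nonneg_of_inner fun u => ⟨RCLike.re (inner ℂ u (phi f X Y u)), ?_, ?_⟩
  · exact (hasSum_re_inner_phi hX u).nonneg fun α =>
      mul_nonneg (f.coeff_nonneg α) (re_inner_nonneg hY _)
  · refine (hasSum_inner_phi hX u u).unique ?_
    refine (Complex.ofRealCLM.hasSum (hasSum_re_inner_phi hX u)).congr_fun fun α => ?_
    rw [inner_eq_re (IsSelfAdjoint.of_nonneg hY)]
    simp

theorem form_phi_of_summable {Y : H →L[ℂ] H} (hX : Summable (phiTerm f X Y)) (hY : 0 ≤ Y) :
    form (phi f X Y) = phiForm f X (form Y) := by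
  funext u
  have h := hasSum_re_inner_phi hX u
  rw [form, ← h.tsum_eq, ENNReal.ofReal_tsum_of_nonneg (fun α =>
    mul_nonneg (f.coeff_nonneg α) (re_inner_nonneg hY _)) h.summable]
  simp only [ENNReal.ofReal_mul (f.coeff_nonneg _)]
  rfl

theorem summable_phiTerm (hX : Summable (phiTerm f X 1)) (Y : H →L[ℂ] H) :
    Summable (phiTerm f X Y) := by
  refine summable_phiTerm_of_bound (norm_nonneg (phi f X 1)) (fun h => ?_) Y
  rw [← form_phi_of_summable hX zero_le_one]
  refine ENNReal.ofReal_le_ofReal ((Complex.re_le_norm _).trans ((norm_inner_le_norm _ _).trans ?_))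
  have := (phi f X 1).le_opNorm h
  nlinarith [norm_nonneg h]

/-- The map `Φ_{f,X}` as an endomorphism of the space of bounded operators. -/
noncomputable def phiEnd (hX : Summable (phiTerm f X 1)) : Module.End ℂ (H →L[ℂ] H) where
  toFun := phi f X
  map_add' Y Z := by
    have h := (summable_phiTerm hX Y).tsum_add (summable_phiTerm hX Z)
    have h' : phiTerm f X (Y + Z) = fun α => phiTerm f X Y α + phiTerm f X Z α := by
      funext α
      simp only [phiTerm, ContinuousLinearMap.add_comp, ContinuousLinearMap.comp_add, smul_add,
        ContinuousLinearMapWOT.ofCLM_add]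
    rw [phi, h', h, ContinuousLinearMapWOT.toCLM_add]
    rfl
  map_smul' c Y := by
    have h := (summable_phiTerm hX Y).tsum_const_smul c
    have h' : phiTerm f X (c • Y) = fun α => c • phiTerm f X Y α := by
      funext α
      simp only [phiTerm, ContinuousLinearMap.smul_comp, ContinuousLinearMap.comp_smul,
        ContinuousLinearMapWOT.ofCLM_smul, smul_comm c]
    rw [phi, h', h, ContinuousLinearMapWOT.toCLM_smul]
    rfl

theorem phiEnd_nonneg (hX : Summable (phiTerm f X 1)) {Y : H →L[ℂ] H} (hY : 0 ≤ Y) :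
    0 ≤ phiEnd hX Y :=
  phi_nonneg_of_summable (summable_phiTerm hX Y) hY

theorem form_phiEnd (hX : Summable (phiTerm f X 1)) {Y : H →L[ℂ] H} (hY : 0 ≤ Y) :
    form (phiEnd hX Y) = phiForm f X (form Y) :=
  form_phi_of_summable (summable_phiTerm hX Y) hY

end Phi

theorem commute_wordOp_right {M : ℕ} {A : H →L[ℂ] H} {Z : Fin M → (H →L[ℂ] H)}
    (h : ∀ b, Commute A (Z b)) (β : FreeMonoid (Fin M)) : Commute A (wordOp Z β) := by
  induction β using FreeMonoid.inductionOn' with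
  | one => rw [wordOp, map_one]; exact Commute.one_right _
  | of_mul b β ih =>
    have : wordOp Z (FreeMonoid.of b * β) = Z b * wordOp Z β := by
      rw [wordOp, map_mul, FreeMonoid.lift_eval_of]
      rfl
    rw [this]
    exact (h b).mul_right ih

theorem commute_wordOp {M N : ℕ} {X : Fin N → (H →L[ℂ] H)} {Z : Fin M → (H →L[ℂ] H)}
    (h : ∀ a b, Commute (X a) (Z b)) (α : FreeMonoid (Fin N)) (β : FreeMonoid (Fin M)) :
    Commute (wordOp X α) (wordOp Z β) :=
  commute_wordOp_right (fun b => (commute_wordOp_right (fun a => (h a b).symm) α).symm) β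

theorem Commute.adjoint {A B : H →L[ℂ] H} (h : Commute A B) :
    Commute (ContinuousLinearMap.adjoint A) (ContinuousLinearMap.adjoint B) := by
  have := congrArg ContinuousLinearMap.adjoint h.eq.symm
  simp only [ContinuousLinearMap.mul_def, ContinuousLinearMap.adjoint_comp] at this
  exact this

theorem phiForm_comm {M N : ℕ} (f : PosRegular N) (g : PosRegular M) {X : Fin N → (H →L[ℂ] H)}
    {Z : Fin M → (H →L[ℂ] H)} (h : ∀ a b, Commute (X a) (Z b)) (q : H → ℝ≥0∞) :
    phiForm f X (phiForm g Z q) = phiForm g Z (phiForm f X q) := by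
  funext x
  simp only [phiForm, ← ENNReal.tsum_mul_left]
  rw [ENNReal.tsum_comm]
  refine tsum_congr fun β => tsum_congr fun α => ?_
  have h1 := congrArg (fun A : H →L[ℂ] H => A x) (Commute.adjoint (commute_wordOp h α β)).eq
  simp only [mul_apply_eq_comp] at h1
  rw [h1, mul_left_comm]

/-- Positive operators span `B(H)`, and on a positive operator the two orders of composition are two
rearrangements of one double series of nonnegative terms. -/
theorem phiEnd_commute {M N : ℕ} {f : PosRegular N} {g : PosRegular M} {X : Fin N → (H →L[ℂ] H)}
    {Z : Fin M → (H →L[ℂ] H)} (h : ∀ a b, Commute (X a) (Z b))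
    (hX : Summable (phiTerm f X 1)) (hZ : Summable (phiTerm g Z 1)) :
    Commute (phiEnd hX) (phiEnd hZ) := by
  refine LinearMap.ext_on CStarAlgebra.span_nonneg fun Y hY => ?_
  simp only [Module.End.mul_apply]
  refine eq_of_form_eq (phiEnd_nonneg hX (phiEnd_nonneg hZ hY))
    (phiEnd_nonneg hZ (phiEnd_nonneg hX hY)) ?_
  rw [form_phiEnd hX (phiEnd_nonneg hZ hY), form_phiEnd hZ hY,
    form_phiEnd hZ (phiEnd_nonneg hX hY), form_phiEnd hX hY, phiForm_comm f g h]

end Polydomain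

namespace Polydomain

variable {H : Type*} [NormedAddCommGroup H] [InnerProductSpace ℂ H] [CompleteSpace H]

/-! ### Positive contractive maps on `B(H)` -/

/-- Positive maps `Φ` on `B(H)` with `Φ(1) ≤ 1`. -/
structure IsPosContr (Φ : Module.End ℂ (H →L[ℂ] H)) : Prop where
  nonneg : ∀ Y, 0 ≤ Y → 0 ≤ Φ Y
  one_le : Φ 1 ≤ 1

theorem ofReal_smul_one_nonneg {c : ℝ} (hc : 0 ≤ c) : 0 ≤ (c : ℂ) • (1 : H →L[ℂ] H) := by
  rw [ContinuousLinearMap.nonneg_iff_isPositive]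
  exact ContinuousLinearMap.isPositive_one.smul_of_nonneg (by exact_mod_cast hc)

theorem exists_bound_of_isSelfAdjoint {Y : H →L[ℂ] H} (hY : IsSelfAdjoint Y) :
    ∃ c : ℝ, 0 ≤ c ∧ 0 ≤ (c : ℂ) • (1 : H →L[ℂ] H) - Y ∧ 0 ≤ (c : ℂ) • (1 : H →L[ℂ] H) + Y := by
  have key : ∀ Z : H →L[ℂ] H, IsSelfAdjoint Z →
      0 ≤ ((‖Z‖ : ℝ) : ℂ) • (1 : H →L[ℂ] H) - Z := fun Z hZ => by
    have h5 : 0 ≤ ((‖Z‖ : ℝ) : ℂ) • (1 : H →L[ℂ] H) :=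
      ofReal_smul_one_nonneg (c := ‖Z‖) (norm_nonneg Z)
    have hsa : IsSelfAdjoint (((‖Z‖ : ℝ) : ℂ) • (1 : H →L[ℂ] H) - Z) :=
      IsSelfAdjoint.sub (IsSelfAdjoint.of_nonneg h5) hZ
    refine nonneg_of_re_inner hsa fun x => ?_
    have h1 : RCLike.re (inner ℂ x ((((‖Z‖ : ℝ) : ℂ) • (1 : H →L[ℂ] H) - Z) x)) =
        ‖Z‖ * ‖x‖ ^ 2 - RCLike.re (inner ℂ x (Z x)) := by
      have h0 : (((‖Z‖ : ℝ) : ℂ) • (1 : H →L[ℂ] H) - Z) x = ((‖Z‖ : ℝ) : ℂ) • x - Z x := rfl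
      have h4 : RCLike.re (((‖Z‖ : ℝ) : ℂ) * inner ℂ x x) = ‖Z‖ * ‖x‖ ^ 2 := by
        rw [← inner_self_eq_norm_sq (𝕜 := ℂ) x]
        exact Complex.re_ofReal_mul _ _
      rw [h0, inner_sub_right, map_sub, inner_smul_right, h4]
    rw [h1]
    have h2 := (Complex.re_le_norm _).trans (norm_inner_le_norm (𝕜 := ℂ) x (Z x))
    have h3 := Z.le_opNorm x
    change RCLike.re (inner ℂ x (Z x)) ≤ _ at h2
    have h4 := mul_le_mul_of_nonneg_left h3 (norm_nonneg x)
    linarith [mul_left_comm ‖x‖ ‖Z‖ ‖x‖, sq ‖x‖, congrArg (‖Z‖ * ·) (sq ‖x‖)]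
  refine ⟨‖Y‖, norm_nonneg _, key Y hY, ?_⟩
  have := key (-Y) hY.neg
  rwa [norm_neg, sub_neg_eq_add] at this

namespace IsPosContr

variable {Φ : Module.End ℂ (H →L[ℂ] H)} (hΦ : IsPosContr Φ)
include hΦ

theorem mono {A B : H →L[ℂ] H} (h : A ≤ B) : Φ A ≤ Φ B := by
  have := hΦ.nonneg _ (sub_nonneg.mpr h)
  rwa [map_sub, sub_nonneg] at this

theorem pow (p : ℕ) : IsPosContr (Φ ^ p) := by
  induction p with
  | zero => exact ⟨fun Y hY => by simpa using hY, by simp⟩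
  | succ p ih =>
    refine ⟨fun Y hY => ?_, ?_⟩
    · rw [pow_succ']; exact hΦ.nonneg _ (ih.nonneg _ hY)
    · rw [pow_succ']; exact (hΦ.mono ih.one_le).trans hΦ.one_le

theorem smul_one_sub_nonneg {Y : H →L[ℂ] H} {c : ℝ} (hc : 0 ≤ c)
    (h : 0 ≤ (c : ℂ) • (1 : H →L[ℂ] H) - Y) : 0 ≤ (c : ℂ) • (1 : H →L[ℂ] H) - Φ Y := by
  have h1 := hΦ.nonneg _ h
  rw [map_sub, map_smul] at h1
  have h2 : 0 ≤ (c : ℂ) • ((1 : H →L[ℂ] H) - Φ 1) := by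
    rw [ContinuousLinearMap.nonneg_iff_isPositive]
    exact ((ContinuousLinearMap.nonneg_iff_isPositive _).mp
      (sub_nonneg.mpr hΦ.one_le)).smul_of_nonneg (by exact_mod_cast hc)
  have := add_nonneg h1 h2
  rwa [smul_sub, add_comm, sub_add_sub_cancel] at this

theorem isSelfAdjoint {Y : H →L[ℂ] H} (hY : IsSelfAdjoint Y) : IsSelfAdjoint (Φ Y) := by
  obtain ⟨c, hc, -, h⟩ := exists_bound_of_isSelfAdjoint hY
  have h1 := (IsSelfAdjoint.of_nonneg (hΦ.nonneg _ h)).sub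
    (IsSelfAdjoint.of_nonneg (hΦ.nonneg _ (ofReal_smul_one_nonneg hc)))
  rwa [← map_sub, add_sub_cancel_left] at h1

theorem isSelfAdjoint_one_sub_pow {Y : H →L[ℂ] H} (hY : IsSelfAdjoint Y) (p : ℕ) :
    IsSelfAdjoint (((1 - Φ) ^ p) Y) := by
  induction p with
  | zero => simpa using hY
  | succ p ih => rw [pow_succ']; exact ih.sub (hΦ.isSelfAdjoint ih)

/-- The inequalities -c ≤ Y ≤ c are preserved by every power of Φ because Φ(1) ≤ 1. This bounds the
boundary terms of the telescoping sums below. -/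
theorem abs_re_inner_le {Y : H →L[ℂ] H} (hY : IsSelfAdjoint Y) (x : H) :
    ∃ C : ℝ, ∀ N : ℕ, |RCLike.re (inner ℂ x ((Φ ^ N) Y x))| ≤ C := by
  obtain ⟨c, hc, h1, h2⟩ := exists_bound_of_isSelfAdjoint hY
  have h3 : ∀ Z : H →L[ℂ] H, 0 ≤ (c : ℂ) • (1 : H →L[ℂ] H) - Z →
      RCLike.re (inner ℂ x (Z x)) ≤ RCLike.re (inner ℂ x (((c : ℂ) • (1 : H →L[ℂ] H)) x)) :=
    fun Z hZ => by
      have := re_inner_nonneg hZ x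
      rw [sub_apply, inner_sub_right, map_sub] at this
      linarith
  refine ⟨RCLike.re (inner ℂ x (((c : ℂ) • (1 : H →L[ℂ] H)) x)), fun N => abs_le.mpr ⟨?_, ?_⟩⟩
  · have := h3 _ ((hΦ.pow N).smul_one_sub_nonneg hc (Y := -Y) (by rwa [sub_neg_eq_add]))
    rw [map_neg, neg_apply, inner_neg_right, map_neg] at this
    linarith
  · exact h3 _ ((hΦ.pow N).smul_one_sub_nonneg hc h1)

omit hΦ in
theorem sum_pow_apply (Z : H →L[ℂ] H) (N : ℕ) :
    ∑ p ∈ Finset.range N, (Φ ^ p) ((1 - Φ) Z) = (1 - Φ ^ N) Z := by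
  rw [← geom_sum_mul_neg, Module.End.mul_apply, LinearMap.sum_apply]

theorem sum_re_inner (Z : H →L[ℂ] H) (x : H) (N : ℕ) :
    ∑ p ∈ Finset.range N, RCLike.re (inner ℂ x ((Φ ^ p) ((1 - Φ) Z) x)) =
      RCLike.re (inner ℂ x (Z x)) - RCLike.re (inner ℂ x ((Φ ^ N) Z x)) := by
  have h := congrArg (fun A : H →L[ℂ] H => RCLike.re (inner ℂ x (A x)))
    (sum_pow_apply (Φ := Φ) Z N)
  simp only [sum_apply, inner_sum, map_sum] at h
  rw [h, LinearMap.sub_apply, Module.End.one_apply, sub_apply, inner_sub_right, map_sub]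

theorem pow_le_self {Y : H →L[ℂ] H} (h : 0 ≤ (1 - Φ) Y) (p : ℕ) : (Φ ^ p) Y ≤ Y := by
  rw [LinearMap.sub_apply, Module.End.one_apply, sub_nonneg] at h
  induction p with
  | zero => simp
  | succ p ih =>
    rw [pow_succ']
    exact (hΦ.mono ih).trans h

/-- The hypothesis makes Φ^p (1 - Φ)Y' at most (1 - Φ)Y' for all p. If the form of (1 - Φ)Y' were
negative at some x, the partial sums over p would tend to -∞ there, but they telescope to a bounded
quantity. -/
theorem nonneg_of_one_sub {Y' : H →L[ℂ] H} (hY' : IsSelfAdjoint Y')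
    (h : 0 ≤ (1 - Φ) ((1 - Φ) Y')) : 0 ≤ (1 - Φ) Y' := by
  have hsa : IsSelfAdjoint ((1 - Φ) Y') := by
    simpa using hΦ.isSelfAdjoint_one_sub_pow hY' 1
  refine nonneg_of_re_inner hsa fun x => ?_
  obtain ⟨C, hC⟩ := hΦ.abs_re_inner_le hY' x
  set a := RCLike.re (inner ℂ x ((1 - Φ) Y' x)) with ha
  by_contra! hneg
  -- The telescoped sum has two boundary terms, at 0 and at N, each bounded by C.
  have h1 : ∀ N : ℕ, -(2 * C) ≤ N * a := fun N => by
    have h2 := hΦ.sum_re_inner Y' x N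
    have h3 : ∑ p ∈ Finset.range N, RCLike.re (inner ℂ x ((Φ ^ p) ((1 - Φ) Y') x)) ≤
        ∑ p ∈ Finset.range N, a := Finset.sum_le_sum fun p _ => by
      have := re_inner_nonneg (sub_nonneg.mpr (hΦ.pow_le_self h p)) x
      rw [sub_apply, inner_sub_right, map_sub] at this
      linarith
    rw [h2, Finset.sum_const, Finset.card_range, nsmul_eq_mul] at h3
    have h4 := (abs_le.mp (hC 0)).1
    have h5 := (abs_le.mp (hC N)).2
    rw [pow_zero, Module.End.one_apply] at h4
    linarith
  obtain ⟨N, hN⟩ := exists_nat_gt (2 * C / -a)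
  rw [div_lt_iff₀ (by linarith)] at hN
  have := h1 N
  linarith

/-- Exponents descend one at a time, but only to a positive one: `nonneg_of_one_sub` removes a
factor when another remains, and `Z` itself need not be positive. -/
theorem nonneg_one_sub_pow {Z : H →L[ℂ] H} (hZ : IsSelfAdjoint Z) (s d : ℕ)
    (h : 0 ≤ ((1 - Φ) ^ (s + 1 + d)) Z) : 0 ≤ ((1 - Φ) ^ (s + 1)) Z := by
  induction d with
  | zero => exact h
  | succ d ih =>
    refine ih ?_
    have h1 : s + 1 + (d + 1) = (s + d) + 1 + 1 := by ring
    have h2 : s + 1 + d = (s + d) + 1 := by ring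
    rw [h1, pow_succ', Module.End.mul_apply, pow_succ', Module.End.mul_apply] at h
    rw [h2, pow_succ', Module.End.mul_apply]
    exact hΦ.nonneg_of_one_sub (hΦ.isSelfAdjoint_one_sub_pow hZ _) h

end IsPosContr

/-! ### Geometric series on forms -/

section Geom

variable {N : ℕ} {f : PosRegular N} {X : Fin N → (H →L[ℂ] H)}

theorem form_sum {ι : Type*} (s : Finset ι) (A : ι → H →L[ℂ] H) (hA : ∀ i, 0 ≤ A i) (h : H) :
    form (∑ i ∈ s, A i) h = ∑ i ∈ s, form (A i) h := by
  classical
  induction s using Finset.induction_on with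
  | empty => simp [form]
  | insert a s ha ih =>
    rw [Finset.sum_insert ha, Finset.sum_insert ha,
      form_add (hA a) (Finset.sum_nonneg fun i _ => hA i), ih]

theorem form_phiEnd_pow (hX : Summable (phiTerm f X 1)) (hΦ : IsPosContr (phiEnd hX))
    {Y : H →L[ℂ] H} (hY : 0 ≤ Y) (p : ℕ) :
    form ((phiEnd hX ^ p) Y) = (phiForm f X)^[p] (form Y) := by
  induction p with
  | zero => simp
  | succ p ih =>
    rw [pow_succ', Module.End.mul_apply, form_phiEnd hX ((hΦ.pow p).nonneg _ hY), ih,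
      Function.iterate_succ_apply']

theorem geomForm_form_one_sub (hX : Summable (phiTerm f X 1)) (hΦ : IsPosContr (phiEnd hX))
    {Z : H →L[ℂ] H} (hZ : 0 ≤ (1 - phiEnd hX) Z) :
    geomForm f X (form ((1 - phiEnd hX) Z)) =
      fun h => ⨆ M : ℕ, form ((1 - phiEnd hX ^ M) Z) h := by
  funext h
  rw [geomForm, ENNReal.tsum_eq_iSup_nat]
  refine iSup_congr fun M => ?_
  rw [← IsPosContr.sum_pow_apply, form_sum _ _ fun p => (hΦ.pow p).nonneg _ hZ]
  simp only [form_phiEnd_pow hX hΦ hZ]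

/-- Here the geometric series inverts 1 - Φ exactly. The remainder Φ^M (1 - Φ)Z tends to zero in
form, being the general term of a series of nonnegative numbers whose telescoping partial sums are
bounded. -/
theorem geomForm_form_one_sub_sq (hX : Summable (phiTerm f X 1)) (hΦ : IsPosContr (phiEnd hX))
    {Z : H →L[ℂ] H} (hZ : IsSelfAdjoint Z) (h0 : 0 ≤ (1 - phiEnd hX) ((1 - phiEnd hX) Z)) :
    geomForm f X (form ((1 - phiEnd hX) ((1 - phiEnd hX) Z))) =
      form ((1 - phiEnd hX) Z) := by
  have h1 := hΦ.nonneg_of_one_sub hZ h0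
  rw [geomForm_form_one_sub hX hΦ h0]
  funext x
  refine le_antisymm (iSup_le fun M => form_mono ?_ x) ?_
  · rw [LinearMap.sub_apply (1 : Module.End ℂ _) (phiEnd hX ^ M), Module.End.one_apply]
    exact sub_le_self _ ((hΦ.pow M).nonneg _ h1)
  · set a : ℕ → ℝ := fun p => RCLike.re (inner ℂ x ((phiEnd hX ^ p) ((1 - phiEnd hX) Z) x)) with ha
    have hnn : ∀ p, 0 ≤ a p := fun p => re_inner_nonneg ((hΦ.pow p).nonneg _ h1) x
    obtain ⟨C, hC⟩ := hΦ.abs_re_inner_le hZ x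
    have hsum : Summable a := by
      refine summable_of_sum_range_le (c := 2 * C) hnn fun M => ?_
      rw [hΦ.sum_re_inner]
      have h4 := (abs_le.mp (hC 0)).2
      have h5 := (abs_le.mp (hC M)).1
      rw [pow_zero, Module.End.one_apply] at h4
      linarith
    have hlim : Filter.Tendsto (fun M => ENNReal.ofReal (a 0 - a M)) Filter.atTop
        (nhds (ENNReal.ofReal (a 0 - 0))) :=
      ENNReal.tendsto_ofReal (tendsto_const_nhds.sub hsum.tendsto_atTop_zero)
    have h6 : form ((1 - phiEnd hX) Z) x = ENNReal.ofReal (a 0 - 0) := by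
      simp [ha, form]
    rw [h6]
    refine le_of_tendsto' hlim fun M => le_iSup_of_le M (le_of_eq ?_)
    have h7 : (1 - phiEnd hX ^ M) ((1 - phiEnd hX) Z) x =
        (phiEnd hX ^ 0) ((1 - phiEnd hX) Z) x - (phiEnd hX ^ M) ((1 - phiEnd hX) Z) x := rfl
    rw [form, h7, inner_sub_right, map_sub]

/-- All but the last application of the geometric series cancel a factor 1 - Φ exactly. Only at the
last one can Φ^M Z fail to vanish in the limit, which leaves the supremum. -/
theorem geomForm_iterate_form (hX : Summable (phiTerm f X 1)) (hΦ : IsPosContr (phiEnd hX))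
    {Z : H →L[ℂ] H} (hZ : IsSelfAdjoint Z) (m : ℕ) (h0 : 0 ≤ ((1 - phiEnd hX) ^ (m + 1)) Z) :
    (geomForm f X)^[m + 1] (form (((1 - phiEnd hX) ^ (m + 1)) Z)) =
      fun h => ⨆ M : ℕ, form ((1 - phiEnd hX ^ M) Z) h := by
  induction m with
  | zero =>
    rw [zero_add, pow_one] at *
    exact geomForm_form_one_sub hX hΦ h0
  | succ m ih =>
    have h1 := hΦ.nonneg_one_sub_pow hZ m 1 h0
    rw [pow_succ', Module.End.mul_apply, pow_succ', Module.End.mul_apply] at h0 ⊢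
    rw [Function.iterate_succ_apply,
      geomForm_form_one_sub_sq hX hΦ (hΦ.isSelfAdjoint_one_sub_pow hZ m) h0]
    rw [← ih h1, pow_succ', Module.End.mul_apply]

/-- Monotone convergence for series; it lets suprema pass through the weighted sums. -/
theorem tsum_iSup_of_monotone {ι : Type*} {q : ι → ℕ → ℝ≥0∞} (hq : ∀ i, Monotone (q i)) :
    ∑' i, ⨆ M, q i M = ⨆ M, ∑' i, q i M := by
  simp only [ENNReal.tsum_eq_iSup_sum]
  rw [iSup_comm]
  exact iSup_congr fun s => ENNReal.finsetSum_iSup_of_monotone fun i => hq i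

theorem weightForm_iSup (m : ℕ) {q : ℕ → H → ℝ≥0∞} (hq : Monotone q) :
    weightForm f m X (fun h => ⨆ M, q M h) = fun h => ⨆ M, weightForm f m X (q M) h := by
  funext h
  simp only [weightForm, ENNReal.mul_iSup]
  exact tsum_iSup_of_monotone fun α a b hab => mul_le_mul_right (hq hab _) _

theorem weightForm_mono (m : ℕ) : Monotone (weightForm f m X) := fun _ _ hq _ =>
  ENNReal.tsum_le_tsum fun _ => mul_le_mul_right (hq _) _

end Geom

end Polydomain

namespace Polydomain

variable {H : Type*} [NormedAddCommGroup H] [InnerProductSpace ℂ H] [CompleteSpace H]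

/-! ### Commuting families of positive contractive maps -/

section Family

variable {ι : Type*} (Φ : ι → Module.End ℂ (H →L[ℂ] H)) (m : ι → ℕ)

/-- Positivity of all the defects `∏_{i ∈ l} (1 - Φ_i)^{ε_i m_i} (Z)`, `ε_i ∈ {0, 1}`. -/
def DefectsNonneg : List ι → (H →L[ℂ] H) → Prop
  | [], Z => 0 ≤ Z
  | i :: l, Z => DefectsNonneg l Z ∧ DefectsNonneg l (((1 - Φ i) ^ m i) Z)

/-- The defect `∏_{i ∈ l} (1 - Φ_i)^{p_i} (Z)`. -/
def listDefect (p : ι → ℕ) (l : List ι) (Z : H →L[ℂ] H) : H →L[ℂ] H :=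
  l.foldr (fun i Z => ((1 - Φ i) ^ p i) Z) Z

/-- The operator `∏_{i ∈ l} (1 - Φ_i^{q_i}) (Z)`. -/
def listNet (q : ι → ℕ) (l : List ι) (Z : H →L[ℂ] H) : H →L[ℂ] H :=
  l.foldl (fun Z i => (1 - Φ i ^ q i) Z) Z

variable {Φ m}

theorem listDefect_comm (p : ι → ℕ) (l : List ι) {A : Module.End ℂ (H →L[ℂ] H)}
    (hA : ∀ i, Commute A (Φ i)) (Z : H →L[ℂ] H) :
    listDefect Φ p l (A Z) = A (listDefect Φ p l Z) := by
  induction l with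
  | nil => rfl
  | cons i l ih =>
    have h : Commute ((1 - Φ i) ^ p i) A :=
      (((Commute.one_right A).sub_right (hA i)).pow_right (p i)).symm
    change ((1 - Φ i) ^ p i) (listDefect Φ p l (A Z)) = A (((1 - Φ i) ^ p i) (listDefect Φ p l Z))
    rw [ih]
    exact LinearMap.congr_fun h.eq _

theorem listNet_sub (q : ι → ℕ) (l : List ι) (Z Z' : H →L[ℂ] H) :
    listNet Φ q l (Z - Z') = listNet Φ q l Z - listNet Φ q l Z' := by
  induction l generalizing Z Z' with
  | nil => rfl
  | cons i l ih =>
    change listNet Φ q l ((1 - Φ i ^ q i) (Z - Z')) = _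
    rw [map_sub, ih]
    rfl

theorem listDefect_sub (p : ι → ℕ) (l : List ι) (Z Z' : H →L[ℂ] H) :
    listDefect Φ p l (Z - Z') = listDefect Φ p l Z - listDefect Φ p l Z' := by
  induction l with
  | nil => rfl
  | cons i l ih =>
    change ((1 - Φ i) ^ p i) (listDefect Φ p l (Z - Z')) = _
    rw [ih, map_sub]
    rfl

theorem listNet_congr {q q' : ι → ℕ} {l : List ι} (h : ∀ i ∈ l, q i = q' i) (Z : H →L[ℂ] H) :
    listNet Φ q l Z = listNet Φ q' l Z := by
  induction l generalizing Z with
  | nil => rfl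
  | cons i l ih =>
    change listNet Φ q l ((1 - Φ i ^ q i) Z) = listNet Φ q' l ((1 - Φ i ^ q' i) Z)
    rw [h i (by simp), ih fun j hj => h j (by simp [hj])]

namespace DefectsNonneg

theorem nonneg {l : List ι} {Z : H →L[ℂ] H} (h : DefectsNonneg Φ m l Z) : 0 ≤ Z := by
  induction l with
  | nil => exact h
  | cons i l ih => exact ih h.1

theorem add {l : List ι} {Z Z' : H →L[ℂ] H} (h : DefectsNonneg Φ m l Z)
    (h' : DefectsNonneg Φ m l Z') : DefectsNonneg Φ m l (Z + Z') := by
  induction l generalizing Z Z' with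
  | nil => exact add_nonneg (α := H →L[ℂ] H) h h'
  | cons i l ih => exact ⟨ih h.1 h'.1, by rw [map_add]; exact ih h.2 h'.2⟩

theorem zero (l : List ι) : DefectsNonneg Φ m l (0 : H →L[ℂ] H) := by
  induction l with
  | nil => exact le_refl (0 : H →L[ℂ] H)
  | cons i l ih => exact ⟨ih, by rw [map_zero]; exact ih⟩

theorem sum {l : List ι} {κ : Type*} (s : Finset κ) {Z : κ → H →L[ℂ] H}
    (h : ∀ j, DefectsNonneg Φ m l (Z j)) : DefectsNonneg Φ m l (∑ j ∈ s, Z j) := by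
  classical
  induction s using Finset.induction_on with
  | empty => exact zero l
  | insert a s ha ih => rw [Finset.sum_insert ha]; exact (h a).add ih

variable (hc : ∀ i j, Commute (Φ i) (Φ j)) (hΦ : ∀ i, IsPosContr (Φ i))
include hc

theorem commute_one_sub_pow (i j : ι) (p : ℕ) : Commute (Φ i) ((1 - Φ j) ^ p) :=
  ((Commute.one_right _).sub_right (hc i j)).pow_right p

theorem commute_one_sub_pow' (i j : ι) (p : ℕ) : Commute (1 - Φ i ^ p) (Φ j) :=
  (Commute.one_left _).sub_left ((hc i j).pow_left p)

theorem commute_pow_one_sub (i j : ι) (p : ℕ) : Commute ((1 - Φ i) ^ p) (Φ j) :=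
  (commute_one_sub_pow hc j i p).symm

include hΦ

theorem map {l : List ι} {Z : H →L[ℂ] H} (h : DefectsNonneg Φ m l Z) (i : ι) :
    DefectsNonneg Φ m l (Φ i Z) := by
  induction l generalizing Z with
  | nil => exact (hΦ i).nonneg _ h
  | cons j l ih =>
    refine ⟨ih h.1, ?_⟩
    have := LinearMap.congr_fun (commute_one_sub_pow hc i j (m j)).eq Z
    simp only [Module.End.mul_apply] at this
    rw [← this]
    exact ih h.2

theorem map_pow {l : List ι} {Z : H →L[ℂ] H} (h : DefectsNonneg Φ m l Z) (i : ι) (p : ℕ) :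
    DefectsNonneg Φ m l ((Φ i ^ p) Z) := by
  induction p with
  | zero => simpa using h
  | succ p ih => rw [pow_succ']; exact map hc hΦ ih i

variable (hm : ∀ i, 1 ≤ m i)
include hm

/-- Lowers the exponent of `i` from `m i` to 1 in every branch of the recursion; commutation allows
each branch to be treated by the case of a single map. -/
theorem one_sub {l : List ι} {Z : H →L[ℂ] H} {i : ι} (h : DefectsNonneg Φ m (i :: l) Z) :
    DefectsNonneg Φ m l ((1 - Φ i) Z) := by
  obtain ⟨h1, h2⟩ := h
  induction l generalizing Z with
  | nil =>
    -- The form required by `nonneg_one_sub_pow`: target exponent 0 + 1, with `m i - 1` factors to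
    -- remove.
    have h3 : m i = 0 + 1 + (m i - 1) := by have := hm i; omega
    have := (hΦ i).nonneg_one_sub_pow (IsSelfAdjoint.of_nonneg h1) 0 (m i - 1) (by rw [← h3]; exact h2)
    change 0 ≤ _
    simpa only [zero_add, pow_one] using this
  | cons j l ih =>
    refine ⟨ih h1.1 h2.1, ?_⟩
    have h4 : Commute (1 - Φ i) ((1 - Φ j) ^ m j) :=
      (Commute.one_left _).sub_left (commute_one_sub_pow hc i j (m j))
    have h5 := LinearMap.congr_fun h4.eq Z
    have h6 := LinearMap.congr_fun (h4.pow_left (m i)).eq Z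
    simp only [Module.End.mul_apply] at h5 h6
    rw [← h5]
    refine ih h1.2 ?_
    rw [h6]
    exact h2.2

theorem one_sub_pow {l : List ι} {Z : H →L[ℂ] H} {i : ι} (h : DefectsNonneg Φ m (i :: l) Z)
    (p : ℕ) : DefectsNonneg Φ m l ((1 - Φ i ^ p) Z) := by
  rw [← IsPosContr.sum_pow_apply]
  exact sum _ fun j => map_pow hc hΦ (one_sub hc hΦ hm h) i j

/-- The difference equals Φ^a (1 - Φ^c) Z with c = b - a, so the previous lemmas apply. This is the
source of the monotonicity of the nets. -/
theorem pow_sub_pow {l : List ι} {Z : H →L[ℂ] H} {i : ι} (h : DefectsNonneg Φ m (i :: l) Z)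
    {a b : ℕ} (hab : a ≤ b) :
    DefectsNonneg Φ m l ((1 - Φ i ^ b) Z - (1 - Φ i ^ a) Z) := by
  obtain ⟨c, rfl⟩ := Nat.exists_eq_add_of_le hab
  have h1 : (1 - Φ i ^ (a + c)) Z - (1 - Φ i ^ a) Z = (Φ i ^ a) ((1 - Φ i ^ c) Z) := by
    rw [← LinearMap.sub_apply, ← Module.End.mul_apply, mul_sub, ← pow_add, mul_one,
      sub_sub_sub_cancel_left]
  rw [h1]
  exact map_pow hc hΦ (one_sub_pow hc hΦ hm h c) i a

theorem listDefect_nonneg {l : List ι} {Z : H →L[ℂ] H} (h : DefectsNonneg Φ m l Z) :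
    0 ≤ listDefect Φ m l Z := by
  induction l generalizing Z with
  | nil => exact h
  | cons i l ih =>
    change 0 ≤ ((1 - Φ i) ^ m i) (listDefect Φ m l Z)
    rw [← listDefect_comm _ _ (commute_pow_one_sub hc i · (m i))]
    exact ih h.2

theorem listNet_nonneg {l : List ι} {Z : H →L[ℂ] H} (h : DefectsNonneg Φ m l Z) (q : ι → ℕ) :
    0 ≤ listNet Φ q l Z := by
  induction l generalizing Z with
  | nil => exact h
  | cons i l ih => exact ih (one_sub_pow hc hΦ hm h (q i))

theorem listNet_le {l : List ι} {Z : H →L[ℂ] H} (h : DefectsNonneg Φ m l Z) (q : ι → ℕ) :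
    listNet Φ q l Z ≤ Z := by
  induction l generalizing Z with
  | nil => exact le_refl Z
  | cons i l ih =>
    refine (ih (one_sub_pow hc hΦ hm h (q i))).trans ?_
    rw [LinearMap.sub_apply, Module.End.one_apply]
    exact sub_le_self _ (((hΦ i).pow (q i)).nonneg _ h.nonneg)

theorem listNet_mono {l : List ι} {Z : H →L[ℂ] H} (h : DefectsNonneg Φ m l Z) {q q' : ι → ℕ}
    (hq : q ≤ q') : listNet Φ q l Z ≤ listNet Φ q' l Z := by
  induction l generalizing Z with
  | nil => exact le_refl Z
  | cons i l ih =>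
    refine (ih (one_sub_pow hc hΦ hm h (q i))).trans ?_
    have h1 := listNet_nonneg hc hΦ hm (pow_sub_pow hc hΦ hm h (hq i)) q'
    rw [listNet_sub] at h1
    exact sub_nonneg.mp h1

end DefectsNonneg

theorem defectsNonneg_of_listDefect [DecidableEq ι] {l : List ι} (hl : l.Nodup)
    (hc : ∀ i j, Commute (Φ i) (Φ j)) {Z : H →L[ℂ] H}
    (h : ∀ ε : ι → ℕ, (∀ i, ε i = 0 ∨ ε i = 1) → 0 ≤ listDefect Φ (fun i => ε i * m i) l Z) :
    DefectsNonneg Φ m l Z := by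
  induction l generalizing Z with
  | nil => exact h (fun _ => 0) fun _ => Or.inl rfl
  | cons i l ih =>
    have hi : i ∉ l := (List.nodup_cons.mp hl).1
    have hcongr : ∀ {p p' : ι → ℕ} (Z : H →L[ℂ] H), (∀ j ∈ l, p j = p' j) →
        listDefect Φ p l Z = listDefect Φ p' l Z := fun Z hp => by
      unfold listDefect
      exact List.foldr_ext _ _ _ fun j hj Z => by rw [hp j hj]
    -- The two branches at `i` are the exponents 0 and `m i`. Each is read off from the hypothesis
    -- by prescribing ε at `i`, which does not affect the other factors since `i` is not in `l`.
    have key : ∀ e : ℕ, (e = 0 ∨ e = 1) → DefectsNonneg Φ m l (((1 - Φ i) ^ (e * m i)) Z) := by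
      intro e he
      refine ih (List.nodup_cons.mp hl).2 fun ε hε => ?_
      have h1 := h (Function.update ε i e) fun j => by
        by_cases hj : j = i
        · subst hj; simpa using he
        · simpa [hj] using hε j
      change 0 ≤ ((1 - Φ i) ^ (Function.update ε i e i * m i)) (listDefect Φ _ l Z) at h1
      rw [← listDefect_comm _ _ (DefectsNonneg.commute_pow_one_sub hc i · _),
        Function.update_self] at h1
      rwa [hcongr (p' := fun j => ε j * m j)] at h1
      intro j hj
      have : j ≠ i := fun h => hi (h ▸ hj)
      simp [this]
    exact ⟨by simpa using key 0 (Or.inl rfl), by simpa using key 1 (Or.inr rfl)⟩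

end Family

/-! ### The polydomain -/

section MemPolydomain

variable {k : ℕ} {n : Fin k → ℕ}

/-- The composition of the maps `q ↦ ∑_α b_{i,α} q(X_{i,α}^* ·)`, `i ∈ l`. -/
noncomputable def listWeightForm (f : ∀ i, PosRegular (n i)) (m : Fin k → ℕ) (X : OpTuple n H)
    (l : List (Fin k)) (q : H → ℝ≥0∞) : H → ℝ≥0∞ :=
  l.foldl (fun q i => weightForm (f i) (m i) (X i) q) q

variable {f : ∀ i, PosRegular (n i)} {m : Fin k → ℕ} {X : OpTuple n H}

theorem listWeightForm_mono (l : List (Fin k)) : Monotone (listWeightForm f m X l) := by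
  induction l with
  | nil => exact monotone_id
  | cons i l ih => exact fun q q' h => ih (weightForm_mono (m i) h)

theorem listWeightForm_iSup (l : List (Fin k)) {q : ℕ → H → ℝ≥0∞} (hq : Monotone q) :
    listWeightForm f m X l (fun h => ⨆ M, q M h) =
      fun h => ⨆ M, listWeightForm f m X l (q M) h := by
  induction l generalizing q with
  | nil => rfl
  | cons i l ih =>
    change listWeightForm f m X l (weightForm (f i) (m i) (X i) _) = _
    rw [weightForm_iSup (m i) hq]
    exact ih fun a b hab => weightForm_mono (m i) (hq hab)

/-- For the head index, the weighted sum turns (1 - Φ_i)^{m_i} into the supremum of 1 - Φ_i^M. By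
commutation this factor moves inside onto `Z`, and induction applies to (1 - Φ_i^M) Z. -/
theorem listWeightForm_listDefect (hX : ∀ i, Summable (phiTerm (f i) (X i) 1))
    (hc : ∀ i j, Commute (phiEnd (hX i)) (phiEnd (hX j)))
    (hΦ : ∀ i, IsPosContr (phiEnd (hX i))) (hm : ∀ i, 1 ≤ m i) {l : List (Fin k)} (hl : l.Nodup)
    {Z : H →L[ℂ] H} (hZ : DefectsNonneg (fun i => phiEnd (hX i)) m l Z) :
    listWeightForm f m X l (form (listDefect (fun i => phiEnd (hX i)) m l Z)) =
      fun h => ⨆ q, form (listNet (fun i => phiEnd (hX i)) q l Z) h := by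
  induction l generalizing Z with
  | nil =>
    funext h
    exact (ciSup_const (ι := Fin k → ℕ) (a := form Z h)).symm
  | cons i l ih =>
    set Φ : Fin k → Module.End ℂ (H →L[ℂ] H) := fun i => phiEnd (hX i) with hΦdef
    obtain ⟨hi, hl'⟩ := List.nodup_cons.mp hl
    have hdef : 0 ≤ listDefect Φ m l Z := DefectsNonneg.listDefect_nonneg hc hΦ hm hZ.1
    have hdef' : 0 ≤ ((1 - Φ i) ^ m i) (listDefect Φ m l Z) :=
      DefectsNonneg.listDefect_nonneg hc hΦ hm hZ
    obtain ⟨m', hm'⟩ := Nat.exists_eq_add_of_le' (hm i)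
    have h1 : weightForm (f i) (m i) (X i) (form (((1 - Φ i) ^ m i) (listDefect Φ m l Z))) =
        fun h => ⨆ M : ℕ, form (listDefect Φ m l ((1 - Φ i ^ M) Z)) h := by
      rw [weightForm_eq _ (hm i)]
      rw [hm'] at hdef' ⊢
      rw [geomForm_iterate_form (hX i) (hΦ i) (IsSelfAdjoint.of_nonneg hdef) m' hdef']
      funext h
      exact iSup_congr fun M => by
        rw [listDefect_comm _ _ (DefectsNonneg.commute_one_sub_pow' hc i · M)]
    change listWeightForm f m X l
      (weightForm (f i) (m i) (X i) (form (((1 - Φ i) ^ m i) (listDefect Φ m l Z)))) = _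
    rw [h1, listWeightForm_iSup]
    · funext h
      have h2 : ∀ M : ℕ, listWeightForm f m X l (form (listDefect Φ m l ((1 - Φ i ^ M) Z))) h =
          ⨆ q, form (listNet Φ q l ((1 - Φ i ^ M) Z)) h := fun M =>
        congrFun (ih hl' (DefectsNonneg.one_sub_pow hc hΦ hm hZ M)) h
      simp only [h2]
      -- The suprema over M and over q merge: since `i` does not occur in `l`, the value of q at `i`
      -- is free and can carry M.
      refine le_antisymm (iSup_le fun M => iSup_le fun q => ?_) (iSup_le fun q => ?_)
      · refine le_iSup_of_le (Function.update q i M) (le_of_eq ?_)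
        change _ = form (listNet Φ (Function.update q i M) l
          ((1 - Φ i ^ (Function.update q i M i)) Z)) h
        rw [Function.update_self]
        congr 1
        refine listNet_congr (fun j hj => ?_) _
        have : j ≠ i := fun h => hi (h ▸ hj)
        simp [this]
      · exact le_iSup_of_le (q i) (le_iSup_of_le q le_rfl)
    · intro a b hab h
      refine form_mono ?_ h
      rw [← sub_nonneg, ← listDefect_sub]
      exact DefectsNonneg.listDefect_nonneg hc hΦ hm
        (DefectsNonneg.pow_sub_pow hc hΦ hm hZ hab)

theorem defect_eq_listDefect (hX : ∀ i, Summable (phiTerm (f i) (X i) 1)) (p : Fin k → ℕ)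
    (Y : H →L[ℂ] H) :
    defect f X p Y = listDefect (fun i => phiEnd (hX i)) p (List.finRange k) Y := by
  unfold defect listDefect
  refine List.foldr_ext _ _ _ fun i _ Z => ?_
  rw [Module.End.pow_apply]
  rfl

namespace MemPolydomain

variable (hX : MemPolydomain f m X)
include hX

theorem phiEnd_commute (i j : Fin k) :
    Commute (phiEnd (hX.summable i)) (phiEnd (hX.summable j)) := by
  by_cases h : i = j
  · subst h; exact Commute.refl _
  · exact Polydomain.phiEnd_commute (hX.commute i j h) _ _

theorem isPosContr (i : Fin k) : IsPosContr (phiEnd (hX.summable i)) :=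
  ⟨fun _ => phiEnd_nonneg _, hX.phi_le i⟩

theorem defect_eq (p : Fin k → ℕ) (Y : H →L[ℂ] H) :
    defect f X p Y = listDefect (fun i => phiEnd (hX.summable i)) p (List.finRange k) Y :=
  defect_eq_listDefect hX.summable p Y

theorem pureNet_eq (q : Fin k → ℕ) :
    pureNet f X q = listNet (fun i => phiEnd (hX.summable i)) q (List.finRange k) 1 := by
  unfold pureNet listNet
  refine List.foldl_ext _ _ _ fun Z i _ => ?_
  rw [LinearMap.sub_apply, Module.End.one_apply, Module.End.pow_apply]
  rfl

/-- The two nets multiply the same commuting factors in opposite orders. -/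
theorem cncNet_eq (q : Fin k → ℕ) : cncNet f X q = pureNet f X q := by
  have h1 : cncNet f X q = (List.finRange k).foldr
      (fun i Z => (1 - phiEnd (hX.summable i) ^ q i) Z) 1 := by
    unfold cncNet
    refine List.foldr_ext _ _ _ fun i _ Z => ?_
    rw [LinearMap.sub_apply, Module.End.one_apply, Module.End.pow_apply]
    rfl
  have hcomm : LeftCommutative (fun (i : Fin k) (Z : H →L[ℂ] H) =>
      (1 - phiEnd (hX.summable i) ^ q i) Z) := ⟨fun i j Z => by
    have h : Commute (1 - phiEnd (hX.summable i) ^ q i) (1 - phiEnd (hX.summable j) ^ q j) :=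
      (Commute.one_right _).sub_right
        ((DefectsNonneg.commute_one_sub_pow' (hX.phiEnd_commute) i j (q i)).pow_right (q j))
    exact LinearMap.congr_fun h.eq Z⟩
  rw [h1, hX.pureNet_eq, listNet, List.foldl_eq_foldr_reverse]
  exact (List.reverse_perm (List.finRange k)).symm.foldr_eq _

theorem defectsNonneg : DefectsNonneg (fun i => phiEnd (hX.summable i)) m (List.finRange k) 1 :=
  defectsNonneg_of_listDefect (List.nodup_finRange k) hX.phiEnd_commute fun ε hε => by
    rw [← hX.defect_eq]
    exact hX.defect_nonneg ε hε

variable (hm : ∀ i, 1 ≤ m i)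
include hm

theorem pureNet_nonneg (q : Fin k → ℕ) : 0 ≤ pureNet f X q := by
  rw [hX.pureNet_eq]
  exact hX.defectsNonneg.listNet_nonneg hX.phiEnd_commute hX.isPosContr hm q

theorem pureNet_le_one (q : Fin k → ℕ) : pureNet f X q ≤ 1 := by
  rw [hX.pureNet_eq]
  exact hX.defectsNonneg.listNet_le hX.phiEnd_commute hX.isPosContr hm q

theorem pureNet_mono : Monotone (pureNet f X) := fun q q' hq => by
  rw [hX.pureNet_eq, hX.pureNet_eq]
  exact hX.defectsNonneg.listNet_mono hX.phiEnd_commute hX.isPosContr hm hq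

theorem defect_self_nonneg : 0 ≤ defect f X m 1 := by
  rw [hX.defect_eq]
  exact hX.defectsNonneg.listDefect_nonneg hX.phiEnd_commute hX.isPosContr hm

theorem listWeightForm_defect :
    listWeightForm f m X (List.finRange k) (form (defect f X m 1)) =
      fun h => ⨆ q, form (pureNet f X q) h := by
  simp only [hX.defect_eq, hX.pureNet_eq]
  exact listWeightForm_listDefect hX.summable hX.phiEnd_commute hX.isPosContr hm
    (List.nodup_finRange k) hX.defectsNonneg

end MemPolydomain

end MemPolydomain

end Polydomain

namespace Polydomain

variable {H : Type*} [NormedAddCommGroup H] [InnerProductSpace ℂ H] [CompleteSpace H]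

/-! ### Square roots of positive operators -/

theorem opSqrt_nonneg (A : H →L[ℂ] H) : 0 ≤ opSqrt A := CFC.sqrt_nonneg A

theorem opSqrt_isSelfAdjoint (A : H →L[ℂ] H) : IsSelfAdjoint (opSqrt A) :=
  IsSelfAdjoint.of_nonneg (opSqrt_nonneg A)

theorem adjoint_opSqrt (A : H →L[ℂ] H) : ContinuousLinearMap.adjoint (opSqrt A) = opSqrt A :=
  ContinuousLinearMap.isSelfAdjoint_iff'.mp (opSqrt_isSelfAdjoint A)

theorem opSqrt_comp_opSqrt {A : H →L[ℂ] H} (hA : 0 ≤ A) : opSqrt A ∘L opSqrt A = A :=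
  CFC.sqrt_mul_sqrt_self A hA

theorem opSqrt_opSqrt_apply {A : H →L[ℂ] H} (hA : 0 ≤ A) (x : H) :
    opSqrt A (opSqrt A x) = A x :=
  congrArg (fun B : H →L[ℂ] H => B x) (opSqrt_comp_opSqrt hA)

theorem norm_opSqrt_apply_sq {A : H →L[ℂ] H} (hA : 0 ≤ A) (x : H) :
    ‖opSqrt A x‖ ^ 2 = RCLike.re (inner ℂ x (A x)) := by
  rw [← inner_self_eq_norm_sq (𝕜 := ℂ), ← ContinuousLinearMap.adjoint_inner_right, adjoint_opSqrt,
    opSqrt_opSqrt_apply hA]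

theorem ofReal_norm_opSqrt_sq {A : H →L[ℂ] H} (hA : 0 ≤ A) (x : H) :
    ENNReal.ofReal (‖opSqrt A x‖ ^ 2) = form A x := by
  rw [norm_opSqrt_apply_sq hA, form]

/-- A and A^{1/2} have the same kernel, since ‖A^{1/2}z‖² = ⟨z, A z⟩; passing to orthogonal
complements gives the inclusion. -/
theorem opSqrt_apply_mem {A : H →L[ℂ] H} (hA : 0 ≤ A) (x : H) :
    opSqrt A x ∈ (LinearMap.range A.toLinearMap).topologicalClosure := by
  rw [← Submodule.orthogonal_orthogonal_eq_closure]
  intro z hz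
  have hsa := ContinuousLinearMap.isSelfAdjoint_iff_isSymmetric.mp (IsSelfAdjoint.of_nonneg hA)
  have h1 : A z = 0 := by
    have := hz (A (A z)) ⟨A z, rfl⟩
    rw [← inner_self_eq_zero (𝕜 := ℂ), ← this]
    exact (hsa (A z) z).symm
  have h2 : opSqrt A z = 0 := by
    have := norm_opSqrt_apply_sq hA z
    rw [h1, inner_zero_right, map_zero] at this
    exact norm_eq_zero.mp (pow_eq_zero_iff two_ne_zero |>.mp this)
  rw [← ContinuousLinearMap.adjoint_inner_left, adjoint_opSqrt, h2, inner_zero_left]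

/-! ### Sums over tuples of words -/

/-- The first operator of the product is applied last to `h`, hence lies next to `q`; this is why
the iterated sum is a left fold. -/
theorem tsum_pi_foldl {k : ℕ} {ι : Fin k → Type} (c : ∀ i, ι i → ℝ≥0∞)
    (B : ∀ i, ι i → (H →L[ℂ] H)) (q : H → ℝ≥0∞) (h : H) :
    ∑' β : ∀ i, ι i, (∏ i, c i (β i)) * q (((List.finRange k).map fun i => B i (β i)).prod h) =
      (List.finRange k).foldl (fun q i h => ∑' α, c i α * q (B i α h)) q h := by
  induction k generalizing q h with
  | zero => simp
  | succ k ih =>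
    rw [← (Fin.consEquiv ι).tsum_eq, ENNReal.tsum_prod', ENNReal.tsum_comm, List.finRange_succ,
      List.foldl_cons, List.foldl_map]
    rw [← ih (fun i => c i.succ) (fun i => B i.succ)]
    refine tsum_congr fun β => ?_
    rw [← ENNReal.tsum_mul_left]
    refine tsum_congr fun α => ?_
    rw [Fin.prod_univ_succ, List.map_cons, List.prod_cons, List.map_map]
    simp only [Fin.consEquiv_apply, Fin.cons_zero, Fin.cons_succ, Function.comp_def]
    rw [mul_comm (c 0 α), mul_assoc]
    rfl

/-! ### Existence of the Berezin kernel -/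

section Berezin

variable {k : ℕ} {n : Fin k → ℕ} {f : ∀ i, PosRegular (n i)} {m : Fin k → ℕ} {X : OpTuple n H}

/-- The operator `X_{1,β₁}^* ⋯ X_{k,β_k}^*`. -/
noncomputable def adjointWords (X : OpTuple n H) (β : Words n) : H →L[ℂ] H :=
  ((List.finRange k).map fun i => ContinuousLinearMap.adjoint (wordOp (X i) (β i))).prod

theorem tsum_words (q : H → ℝ≥0∞) (h : H) :
    ∑' β : Words n, ENNReal.ofReal (∏ i, weight (f i) (m i) (β i)) * q (adjointWords X β h) =
      listWeightForm f m X (List.finRange k) q h := by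
  refine Eq.trans ?_ (tsum_pi_foldl (fun i α => ENNReal.ofReal (weight (f i) (m i) α))
    (fun i α => ContinuousLinearMap.adjoint (wordOp (X i) α)) q h)
  refine tsum_congr fun β => ?_
  rw [ENNReal.ofReal_prod_of_nonneg fun i _ => weight_nonneg _ _ _]
  rfl

theorem norm_prod_sqrt_smul_sq (β : Words n) {G : Type*} [NormedAddCommGroup G]
    [InnerProductSpace ℂ G] (y : G) :
    ‖((∏ i, √(weight (f i) (m i) (β i)) : ℝ) : ℂ) • y‖ ^ 2 =
      (∏ i, weight (f i) (m i) (β i)) * ‖y‖ ^ 2 := by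
  rw [norm_smul, mul_pow, Complex.norm_real, Real.norm_eq_abs, sq_abs, ← Finset.prod_pow]
  congr 1
  exact Finset.prod_congr rfl fun i _ => Real.sq_sqrt (weight_nonneg _ _ _)

/-- The kernel is a column operator whose squared norms add up to the left side of `hb`. Asking only
for this bound makes the lemma usable for the companion tuple without proving that it lies in the
polydomain. -/
theorem exists_isBerezinKernel (hΔ : 0 ≤ defect f X m 1)
    (hb : ∀ h, listWeightForm f m X (List.finRange k) (form (defect f X m 1)) h ≤
      ENNReal.ofReal (‖h‖ ^ 2)) : ∃ K, IsBerezinKernel f m X K := by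
  let B : Words n → H →L[ℂ] defectSpace f m X := fun β =>
    ContinuousLinearMap.codRestrict
      (((∏ i, √(weight (f i) (m i) (β i)) : ℝ) : ℂ) •
        (opSqrt (defect f X m 1) ∘L adjointWords X β)) (defectSpace f m X)
      fun h => Submodule.smul_mem _ _ (opSqrt_apply_mem hΔ _)
  obtain ⟨K, hK⟩ := exists_column B zero_le_one fun h => by
    rw [one_mul]
    refine le_trans (le_of_eq ?_) (hb h)
    rw [← tsum_words]
    refine tsum_congr fun β => ?_
    rw [← ofReal_norm_opSqrt_sq hΔ, ← ENNReal.ofReal_mul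
      (Finset.prod_nonneg fun i _ => weight_nonneg _ _ _), ← norm_prod_sqrt_smul_sq]
    rfl
  exact ⟨K, fun h β => by rw [hK]; rfl⟩

theorem IsBerezinKernel.ofReal_norm_sq {K : H →L[ℂ] Fock n (defectSpace f m X)}
    (hK : IsBerezinKernel f m X K) (hΔ : 0 ≤ defect f X m 1) (h : H) :
    ENNReal.ofReal (‖K h‖ ^ 2) =
      listWeightForm f m X (List.finRange k) (form (defect f X m 1)) h := by
  rw [ofReal_norm_sq_eq_tsum, ← tsum_words]
  refine tsum_congr fun β => ?_
  rw [← ofReal_norm_opSqrt_sq hΔ, ← ENNReal.ofReal_mul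
    (Finset.prod_nonneg fun i _ => weight_nonneg _ _ _), ← norm_prod_sqrt_smul_sq]
  have h1 : ‖K h β‖ = ‖((K h β : defectSpace f m X) : H)‖ := rfl
  rw [h1, hK]
  rfl

theorem isBerezinKernel_berezinKernel (h : ∃ K, IsBerezinKernel f m X K) :
    IsBerezinKernel f m X (berezinKernel f m X) := by
  rw [berezinKernel, dif_pos h]
  exact h.choose_spec

namespace MemPolydomain

variable (hX : MemPolydomain f m X) (hm : ∀ i, 1 ≤ m i)
include hX hm

theorem iSup_form_pureNet_le (h : H) : ⨆ q, form (pureNet f X q) h ≤ ENNReal.ofReal (‖h‖ ^ 2) := by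
  refine iSup_le fun q => (form_mono (hX.pureNet_le_one hm q) h).trans (le_of_eq ?_)
  rw [form_one]

theorem isBerezinKernel : IsBerezinKernel f m X (berezinKernel f m X) := by
  refine isBerezinKernel_berezinKernel (exists_isBerezinKernel (hX.defect_self_nonneg hm) fun h => ?_)
  rw [hX.listWeightForm_defect hm]
  exact hX.iSup_form_pureNet_le hm h

theorem ofReal_norm_berezinKernel_sq (h : H) :
    ENNReal.ofReal (‖berezinKernel f m X h‖ ^ 2) = ⨆ q, form (pureNet f X q) h := by
  rw [(hX.isBerezinKernel hm).ofReal_norm_sq (hX.defect_self_nonneg hm),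
    hX.listWeightForm_defect hm]

theorem tendsto_re_inner_pureNet (h : H) :
    Filter.Tendsto (fun q => RCLike.re (inner ℂ h (pureNet f X q h))) Filter.atTop
      (nhds (‖berezinKernel f m X h‖ ^ 2)) := by
  have h1 : Filter.Tendsto (fun q => form (pureNet f X q) h) Filter.atTop
      (nhds (ENNReal.ofReal (‖berezinKernel f m X h‖ ^ 2))) := by
    rw [hX.ofReal_norm_berezinKernel_sq hm]
    exact tendsto_atTop_iSup fun q q' hq => form_mono (hX.pureNet_mono hm hq) h
  have h2 := (ENNReal.tendsto_toReal ENNReal.ofReal_ne_top).comp h1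
  rw [ENNReal.toReal_ofReal (sq_nonneg _)] at h2
  refine h2.congr fun q => ?_
  exact ENNReal.toReal_ofReal (re_inner_nonneg (hX.pureNet_nonneg hm q) h)

/-- The forms of the net increase to ‖K h‖², and by polarization weak operator convergence to I is
convergence of these forms to ‖h‖². -/
theorem isPure_iff : IsPure f X ↔ ∀ h, ‖berezinKernel f m X h‖ = ‖h‖ := by
  rw [IsPure, ContinuousLinearMapWOT.tendsto_iff_forall_inner_apply_tendsto]
  constructor
  · intro hp h
    have h1 := (Complex.continuous_re.tendsto _).comp (hp h h)
    have h2 := tendsto_nhds_unique h1 (hX.tendsto_re_inner_pureNet hm h)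
    have h3 : (inner ℂ h ((ContinuousLinearMapWOT.ofCLM (1 : H →L[ℂ] H)) h)).re = ‖h‖ ^ 2 :=
      inner_self_eq_norm_sq (𝕜 := ℂ) h
    rw [h3] at h2
    exact ((sq_eq_sq₀ (norm_nonneg _) (norm_nonneg _)).mp h2).symm
  · intro hK x y
    have h1 : ∀ z, Filter.Tendsto (fun q => inner ℂ (pureNet f X q z) z) Filter.atTop
        (nhds (inner ℂ z z)) := fun z => by
      have h2 := (Complex.continuous_ofReal.tendsto _).comp (hX.tendsto_re_inner_pureNet hm z)
      rw [hK] at h2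
      have h3 : inner ℂ z z = ((‖z‖ ^ 2 : ℝ) : ℂ) := by
        rw [inner_self_eq_norm_sq_to_K]; simp
      rw [h3]
      refine h2.congr fun q => ?_
      have hsa := IsSelfAdjoint.of_nonneg (hX.pureNet_nonneg hm q)
      have h4 := ContinuousLinearMap.isSelfAdjoint_iff_isSymmetric.mp hsa z z
      exact (inner_eq_re hsa z).symm.trans h4.symm
    have hsa : ∀ q, inner ℂ y (pureNet f X q x) = inner ℂ (pureNet f X q y) x := fun q =>
      (ContinuousLinearMap.isSelfAdjoint_iff_isSymmetric.mp
        (IsSelfAdjoint.of_nonneg (hX.pureNet_nonneg hm q)) y x).symm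
    change Filter.Tendsto (fun q => inner ℂ y (pureNet f X q x)) _ (nhds (inner ℂ y x))
    simp only [hsa]
    have h5 := fun q => inner_map_polarization' (pureNet f X q).toLinearMap y x
    have h6 := inner_map_polarization' (1 : H →ₗ[ℂ] H) y x
    simp only [ContinuousLinearMap.coe_coe, Module.End.one_apply] at h5 h6
    simp only [h5]
    rw [h6]
    exact ((((h1 _).sub (h1 _)).sub ((h1 _).const_mul _)).add ((h1 _).const_mul _)).div_const _

/-- ‖K h‖² is the supremum of the forms of the net at h, so K h = 0 makes all of them vanish there.
-/
theorem injective_of_isCNC (hc : IsCNC f X) {h : H} (hh : berezinKernel f m X h = 0) : h = 0 := by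
  by_contra hne
  refine hc ⟨h, hne, fun q _ => ?_⟩
  have h1 := hX.ofReal_norm_berezinKernel_sq hm h
  rw [hh, norm_zero, zero_pow two_ne_zero, ENNReal.ofReal_zero] at h1
  have h2 : form (pureNet f X q) h = 0 := le_antisymm (h1 ▸ le_iSup (fun q => form (pureNet f X q) h) q) bot_le
  have h3 := le_antisymm (ENNReal.ofReal_eq_zero.mp h2) (re_inner_nonneg (hX.pureNet_nonneg hm q) h)
  have hsa := IsSelfAdjoint.of_nonneg (hX.pureNet_nonneg hm q)
  rw [hX.cncNet_eq]
  refine (ContinuousLinearMap.isSelfAdjoint_iff_isSymmetric.mp hsa h h).trans ?_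
  refine (inner_eq_re hsa h).trans ?_
  rw [h3, Complex.ofReal_zero]

end MemPolydomain

/-! ### The intertwining property of the Berezin kernel -/

theorem list_prod_map_update {M ι : Type*} [Monoid M] [DecidableEq ι] {l : List ι} (hl : l.Nodup)
    {g g' : ι → M} {i : ι} {a : M} (hi : i ∈ l) (hg : g' i = g i * a)
    (hne : ∀ j, j ≠ i → g' j = g j) (hc : ∀ j, j ≠ i → Commute a (g j)) :
    (l.map g').prod = (l.map g).prod * a := by
  induction l with
  | nil => simp at hi
  | cons j l ih =>
    obtain ⟨hj, hl'⟩ := List.nodup_cons.mp hl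
    rw [List.map_cons, List.prod_cons, List.map_cons, List.prod_cons]
    by_cases hij : j = i
    · subst hij
      have h1 : l.map g' = l.map g := List.map_congr_left fun x hx => hne x fun h => hj (h ▸ hx)
      have h2 : Commute a (l.map g).prod := Commute.list_prod_right _ _ fun y hy => by
        obtain ⟨x, hx, rfl⟩ := List.mem_map.mp hy
        exact hc x fun h => hj (h ▸ hx)
      rw [h1, hg, mul_assoc, h2.eq, mul_assoc]
    · rw [ih hl' ((List.mem_cons.mp hi).resolve_left (Ne.symm hij)), hne j hij, mul_assoc]

theorem wordOp_of {N : ℕ} (Z : Fin N → (H →L[ℂ] H)) (j : Fin N) :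
    wordOp Z (FreeMonoid.of j) = Z j :=
  FreeMonoid.lift_eval_of _ _

theorem adjointWords_consWord (hX : ∀ p q, p ≠ q → ∀ a b, Commute (X p a) (X q b)) (i : Fin k)
    (j : Fin (n i)) (β : Words n) (h : H) :
    adjointWords X (consWord i j β) h =
      adjointWords X β (ContinuousLinearMap.adjoint (X i j) h) := by
  have h1 : adjointWords X (consWord i j β) =
      adjointWords X β * ContinuousLinearMap.adjoint (X i j) := by
    refine list_prod_map_update (List.nodup_finRange k) (List.mem_finRange i) ?_ ?_ ?_
    · ext h
      rw [consWord, Function.update_self, adjoint_wordOp_mul, wordOp_of]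
      rfl
    · intro l hl
      rw [consWord, Function.update_of_ne hl]
    · intro l hl
      exact Commute.adjoint (commute_wordOp_right (fun b => hX i l hl.symm j b) _)
  rw [h1]
  rfl

theorem prod_sqrt_weight_consWord (f : ∀ i, PosRegular (n i)) (m : Fin k → ℕ) (i : Fin k)
    (j : Fin (n i)) (β : Words n) :
    shiftWeight f m i j β * ∏ l, √(weight (f l) (m l) (consWord i j β l)) =
      ∏ l, √(weight (f l) (m l) (β l)) := by
  classical
  rw [← Finset.mul_prod_erase _ _ (Finset.mem_univ i), ← Finset.mul_prod_erase _ _ (Finset.mem_univ i),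
    ← mul_assoc]
  congr 1
  · rw [consWord, Function.update_self, shiftWeight]
    exact div_mul_cancel₀ _ (Real.sqrt_pos.mpr (weight_pos _ _ _)).ne'
  · refine Finset.prod_congr rfl fun l hl => ?_
    rw [consWord, Function.update_of_ne (Finset.ne_of_mem_erase hl)]

variable {D : Type*} [NormedAddCommGroup D] [InnerProductSpace ℂ D] [CompleteSpace D]

theorem adjoint_universal_apply (f : ∀ i, PosRegular (n i)) (m : Fin k → ℕ) (i : Fin k)
    (j : Fin (n i)) (x : Fock n D) (β : Words n) :
    (ContinuousLinearMap.adjoint (universal D f m i j) x : Fock n D) β =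
      ((shiftWeight f m i j β : ℝ) : ℂ) • x (consWord i j β) := by
  classical
  refine ext_inner_left ℂ fun d : D => ?_
  refine (lp.inner_single_left (𝕜 := ℂ) (G := fun _ : Words n => D) β d
    (ContinuousLinearMap.adjoint (universal D f m i j) x)).symm.trans ?_
  rw [ContinuousLinearMap.adjoint_inner_right, universal_single]
  refine (lp.inner_single_left (𝕜 := ℂ) (G := fun _ : Words n => D) _ _ x).trans ?_
  rw [inner_smul_left, inner_smul_right, Complex.conj_ofReal]
  rfl

/-- In coordinate β, the weight of the creation operator turns √b of g_jβ_i into √b of β_i, while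
X_{i,j}^* commutes past the factors with other indices to lengthen the i-th word. -/
theorem IsBerezinKernel.intertwine {K : H →L[ℂ] Fock n (defectSpace f m X)}
    (hK : IsBerezinKernel f m X K) (hX : ∀ p q, p ≠ q → ∀ a b, Commute (X p a) (X q b)) (i : Fin k)
    (j : Fin (n i)) (h : H) :
    K (ContinuousLinearMap.adjoint (X i j) h) =
      ContinuousLinearMap.adjoint (universal (defectSpace f m X) f m i j) (K h) := by
  ext β
  rw [adjoint_universal_apply, Submodule.coe_smul, hK, hK, smul_smul]
  have h1 := adjointWords_consWord hX i j β h
  unfold adjointWords at h1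
  rw [h1, ← Complex.ofReal_mul, prod_sqrt_weight_consWord]

end Berezin

end Polydomain

namespace Polydomain

variable {k : ℕ} {n : Fin k → ℕ}

/-! ### Defects from sums of forms -/

section FormDefect

variable {H : Type*} [NormedAddCommGroup H] [InnerProductSpace ℂ H] [CompleteSpace H]

/-- The resolvent equation reads form Z = q + form (Φ Z). Since form (Φ Z) is finite, it can be
subtracted, which yields positivity and the value of (1 - Φ)Z together. -/
theorem one_sub_of_form_eq {N : ℕ} {f : PosRegular N} {X : Fin N → (H →L[ℂ] H)}
    (hX : Summable (phiTerm f X 1)) {Z : H →L[ℂ] H} (hZ : 0 ≤ Z) {q : H → ℝ≥0∞}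
    (h : form Z = geomForm f X q) :
    0 ≤ (1 - phiEnd hX) Z ∧ form ((1 - phiEnd hX) Z) = q := by
  have hΦ := phiEnd_nonneg hX hZ
  have h1 : ∀ x, form Z x = q x + form (phiEnd hX Z) x := fun x => by
    rw [form_phiEnd hX hZ, h]
    exact geomForm_eq f X q x
  have h2 : ∀ x, RCLike.re (inner ℂ x ((1 - phiEnd hX) Z x)) =
      RCLike.re (inner ℂ x (Z x)) - RCLike.re (inner ℂ x (phiEnd hX Z x)) := fun x => by
    rw [LinearMap.sub_apply, Module.End.one_apply, sub_apply, inner_sub_right, map_sub]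
  refine ⟨nonneg_of_re_inner ?_ fun x => ?_, ?_⟩
  · exact IsSelfAdjoint.sub (IsSelfAdjoint.of_nonneg hZ) (IsSelfAdjoint.of_nonneg hΦ)
  · rw [h2, sub_nonneg, ← ENNReal.ofReal_le_ofReal_iff (re_inner_nonneg hZ x)]
    exact le_add_self.trans_eq (h1 x).symm
  · funext x
    rw [form, h2, ENNReal.ofReal_sub _ (re_inner_nonneg hΦ x)]
    change form Z x - form (phiEnd hX Z) x = q x
    rw [h1]
    exact ENNReal.add_sub_cancel_right ENNReal.ofReal_ne_top

theorem one_sub_pow_of_form_eq {N : ℕ} {f : PosRegular N} {X : Fin N → (H →L[ℂ] H)}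
    (hX : Summable (phiTerm f X 1)) (m : ℕ) {Z : H →L[ℂ] H} (hZ : 0 ≤ Z) {q : H → ℝ≥0∞}
    (h : form Z = (geomForm f X)^[m] q) :
    0 ≤ ((1 - phiEnd hX) ^ m) Z ∧ form (((1 - phiEnd hX) ^ m) Z) = q := by
  induction m generalizing Z with
  | zero => exact ⟨hZ, h⟩
  | succ m ih =>
    rw [Function.iterate_succ_apply'] at h
    obtain ⟨h1, h2⟩ := one_sub_of_form_eq hX hZ h
    exact ih h1 h2

variable {f : ∀ i, PosRegular (n i)} {m : Fin k → ℕ} {X : OpTuple n H}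

theorem listDefect_of_form_eq (hX : ∀ i, Summable (phiTerm (f i) (X i) 1)) (hm : ∀ i, 1 ≤ m i)
    {l : List (Fin k)} {Z : H →L[ℂ] H} (hZ : 0 ≤ Z) {q : H → ℝ≥0∞}
    (h : form Z = listWeightForm f m X l q) :
    0 ≤ listDefect (fun i => phiEnd (hX i)) m l Z ∧
      form (listDefect (fun i => phiEnd (hX i)) m l Z) = q := by
  induction l generalizing q with
  | nil => exact ⟨hZ, h⟩
  | cons i l ih =>
    obtain ⟨h1, h2⟩ := ih (q := weightForm (f i) (m i) (X i) q) h
    rw [weightForm_eq _ (hm i)] at h2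
    exact one_sub_pow_of_form_eq (hX i) (m i) h1 h2

theorem phiForm_weightForm_comm {i j : Fin k} (h : ∀ a b, Commute (X i a) (X j b)) (p : ℕ)
    (q : H → ℝ≥0∞) :
    phiForm (f i) (X i) (weightForm (f j) p (X j) q) =
      weightForm (f j) p (X j) (phiForm (f i) (X i) q) := by
  funext x
  simp only [phiForm, weightForm, ← ENNReal.tsum_mul_left]
  rw [ENNReal.tsum_comm]
  refine tsum_congr fun β => tsum_congr fun α => ?_
  have h1 := congrArg (fun A : H →L[ℂ] H => A x) (Commute.adjoint (commute_wordOp h α β)).eq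
  simp only [mul_apply_eq_comp] at h1
  rw [h1, mul_left_comm]

theorem phiForm_weightForm_le {N : ℕ} (g : PosRegular N) (Z : Fin N → (H →L[ℂ] H)) {p : ℕ}
    (hp : 1 ≤ p) (q : H → ℝ≥0∞) : phiForm g Z (weightForm g p Z q) ≤ weightForm g p Z q := by
  obtain ⟨p, rfl⟩ := Nat.exists_eq_add_of_le' hp
  rw [weightForm_eq _ hp, Function.iterate_succ_apply']
  intro x
  rw [geomForm_eq g Z ((geomForm g Z)^[p] q) x]
  exact le_add_self

/-- Φ_i commutes past the sums for the other indices and meets its own geometric series, where Φ ∑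
Φ^p ≤ ∑ Φ^p. For the universal model this is the bound Φ_i(1) ≤ 1. -/
theorem phiForm_listWeightForm_le (hX : ∀ p q, p ≠ q → ∀ a b, Commute (X p a) (X q b))
    (hm : ∀ i, 1 ≤ m i) {i : Fin k} {l : List (Fin k)} (hl : l.Nodup) (hi : i ∈ l)
    (q : H → ℝ≥0∞) :
    phiForm (f i) (X i) (listWeightForm f m X l q) ≤ listWeightForm f m X l q := by
  induction l generalizing q with
  | nil => simp at hi
  | cons j l ih =>
    obtain ⟨hj, hl'⟩ := List.nodup_cons.mp hl
    by_cases hil : i ∈ l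
    · exact ih hl' hil _
    · obtain rfl : i = j := (List.mem_cons.mp hi).resolve_right hil
      have hcomm : ∀ (l : List (Fin k)) (q : H → ℝ≥0∞), i ∉ l →
          phiForm (f i) (X i) (listWeightForm f m X l q) =
            listWeightForm f m X l (phiForm (f i) (X i) q) := by
        intro l
        induction l with
        | nil => exact fun q _ => rfl
        | cons p l ih =>
          intro q hp
          rw [List.mem_cons, not_or] at hp
          refine (ih (weightForm (f p) (m p) (X p) q) hp.2).trans ?_
          rw [phiForm_weightForm_comm (hX i p hp.1)]
          rfl
      refine (hcomm l (weightForm (f i) (m i) (X i) q) hj).trans_le ?_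
      exact listWeightForm_mono l (phiForm_weightForm_le _ _ (hm i) q)

end FormDefect

/-! ### The universal model -/

section Universal

variable {D : Type*} [NormedAddCommGroup D] [InnerProductSpace ℂ D] [CompleteSpace D]
variable {f : ∀ i, PosRegular (n i)} {m : Fin k → ℕ}

/-- The product `√b_{β₁} ⋯ √b_{β_k}`. -/
noncomputable def sqrtWeight (f : ∀ i, PosRegular (n i)) (m : Fin k → ℕ) (β : Words n) : ℝ :=
  ∏ i, √(weight (f i) (m i) (β i))

theorem sqrtWeight_pos (β : Words n) : 0 < sqrtWeight f m β :=
  Finset.prod_pos fun _ _ => Real.sqrt_pos.mpr (weight_pos _ _ _)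

/-- The coordinates of `x` divided by `√b_{β₁} ⋯ √b_{β_k}`. -/
noncomputable def normCoord (f : ∀ i, PosRegular (n i)) (m : Fin k → ℕ) (x : Fock n D)
    (β : Words n) : D :=
  (((sqrtWeight f m β)⁻¹ : ℝ) : ℂ) • x β

theorem normCoord_injective {x y : Fock n D} (h : ∀ β, normCoord f m x β = normCoord f m y β) :
    x = y := by
  ext β
  exact smul_right_injective D (Complex.ofReal_ne_zero.mpr
    (inv_ne_zero (sqrtWeight_pos (f := f) (m := m) β).ne')) (h β)

/-- In the rescaled coordinates the weights cancel and the adjoint creation operators only shift the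
index, so identities between them reduce to identities of words. -/
theorem normCoord_adjoint_universal (i : Fin k) (j : Fin (n i)) (x : Fock n D) (β : Words n) :
    normCoord f m (ContinuousLinearMap.adjoint (universal D f m i j) x) β =
      normCoord f m x (consWord i j β) := by
  rw [normCoord, normCoord, adjoint_universal_apply, smul_smul, ← Complex.ofReal_mul]
  congr 2
  have h1 := prod_sqrt_weight_consWord f m i j β
  have h2 := sqrtWeight_pos (f := f) (m := m) β
  have h3 := sqrtWeight_pos (f := f) (m := m) (consWord i j β)
  change _ * sqrtWeight f m _ = sqrtWeight f m β at h1
  field_simp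
  exact h1

theorem consWord_comm {i p : Fin k} (h : i ≠ p) (a : Fin (n i)) (b : Fin (n p)) (β : Words n) :
    consWord i a (consWord p b β) = consWord p b (consWord i a β) := by
  unfold consWord
  rw [Function.update_of_ne h, Function.update_of_ne h.symm, Function.update_comm h]

theorem universal_commute {i p : Fin k} (h : i ≠ p) (a : Fin (n i)) (b : Fin (n p)) :
    Commute (universal D f m i a) (universal D f m p b) := by
  have h1 : ContinuousLinearMap.adjoint (universal D f m i a * universal D f m p b) =
      ContinuousLinearMap.adjoint (universal D f m p b * universal D f m i a) := by
    simp only [ContinuousLinearMap.mul_def, ContinuousLinearMap.adjoint_comp]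
    refine ContinuousLinearMap.ext fun x => normCoord_injective (f := f) (m := m) fun β => ?_
    simp only [ContinuousLinearMap.comp_apply, normCoord_adjoint_universal]
    rw [consWord_comm h]
  exact ContinuousLinearMap.adjoint.injective h1

theorem normCoord_adjoint_wordOp (i : Fin k) (α : FreeMonoid (Fin (n i))) (x : Fock n D)
    (β : Words n) :
    normCoord f m (ContinuousLinearMap.adjoint (wordOp (universal D f m i) α) x) β =
      normCoord f m x (Function.update β i (α * β i)) := by
  induction α using FreeMonoid.inductionOn' generalizing x with
  | one => rw [adjoint_wordOp_one, one_mul, Function.update_eq_self]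
  | of_mul a α ih =>
    rw [adjoint_wordOp_mul, ih, wordOp_of, normCoord_adjoint_universal, consWord,
      Function.update_self, Function.update_idem, mul_assoc]

theorem normCoord_adjointWords (β : Words n) (x : Fock n D) :
    normCoord f m (adjointWords (fun i j => universal D f m i j) β x) 1 = normCoord f m x β := by
  have h1 : ∀ (l : List (Fin k)) (γ : Words n),
      normCoord f m ((l.map fun i => ContinuousLinearMap.adjoint
        (wordOp (universal D f m i) (β i))).prod x) γ =
      normCoord f m x (l.foldl (fun γ i => Function.update γ i (β i * γ i)) γ) := by
    intro l
    induction l with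
    | nil => exact fun γ => rfl
    | cons i l ih =>
      intro γ
      rw [List.map_cons, List.prod_cons, List.foldl_cons, mul_apply_eq_comp,
        normCoord_adjoint_wordOp, ih]
  have h2 : ∀ (l : List (Fin k)), l.Nodup → ∀ (γ : Words n) (i : Fin k),
      l.foldl (fun γ i => Function.update γ i (β i * γ i)) γ i =
        if i ∈ l then β i * γ i else γ i := by
    intro l
    induction l with
    | nil => intro _ γ i; simp
    | cons j l ih =>
      intro hl γ i
      obtain ⟨hj, hl'⟩ := List.nodup_cons.mp hl
      rw [List.foldl_cons, ih hl']
      by_cases hij : i = j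
      · subst hij
        simp [hj]
      · simp [hij]
  refine (h1 (List.finRange k) 1).trans (congrArg _ (funext fun i => ?_))
  rw [h2 _ (List.nodup_finRange k), if_pos (List.mem_finRange i)]
  exact mul_one _

/-- The form of the projection onto the vacuum vectors. -/
noncomputable def vacuumForm (x : Fock n D) : ℝ≥0∞ := ENNReal.ofReal (‖x 1‖ ^ 2)

/-- Parseval: the adjoint word β brings the rescaled coordinate at β to the vacuum, and the weight
b_β undoes the rescaling. -/
theorem listWeightForm_vacuumForm :
    listWeightForm f m (fun i j => universal D f m i j) (List.finRange k) vacuumForm =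
      form (1 : Fock n D →L[ℂ] Fock n D) := by
  funext x
  rw [form_one, ← tsum_words]
  refine Eq.trans ?_ (ofReal_norm_sq_eq_tsum x).symm
  refine tsum_congr fun β => ?_
  have h1 : ∀ y : Fock n D, y 1 = normCoord f m y 1 := fun y => by
    have h2 : sqrtWeight f m (1 : Words n) = 1 :=
      Finset.prod_eq_one fun i _ => by
        rw [Pi.one_apply, weight_one, Real.sqrt_one]
    rw [normCoord, h2, inv_one, Complex.ofReal_one, one_smul]
  have h3 : x β = ((sqrtWeight f m β : ℝ) : ℂ) • normCoord f m x β := by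
    rw [normCoord, smul_smul, ← Complex.ofReal_mul, mul_inv_cancel₀ (sqrtWeight_pos β).ne',
      Complex.ofReal_one, one_smul]
  rw [vacuumForm, h1, normCoord_adjointWords, h3]
  refine (ENNReal.ofReal_mul (Finset.prod_nonneg fun i _ => weight_nonneg _ _ _)).symm.trans ?_
  rw [sqrtWeight, norm_prod_sqrt_smul_sq]

theorem summable_phiTerm_universal (hm : ∀ i, 1 ≤ m i) (i : Fin k)
    (Y : Fock n D →L[ℂ] Fock n D) : Summable (phiTerm (f i) (universal D f m i) Y) := by
  refine summable_phiTerm_of_bound zero_le_one (fun x => ?_) Y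
  have h1 := phiForm_listWeightForm_le (f := f) (m := m) (X := fun i j => universal D f m i j)
    (fun p q hpq a b => universal_commute hpq a b) hm (List.nodup_finRange k)
    (List.mem_finRange i) vacuumForm x
  rw [listWeightForm_vacuumForm] at h1
  refine h1.trans_eq ?_
  rw [form_one, one_mul]

/-- The Parseval identity exhibits the form of I as the weighted sum of `vacuumForm`; inverting the
geometric series recovers the defect without computing it. -/
theorem defect_universal (hm : ∀ i, 1 ≤ m i) :
    0 ≤ defect f (fun i j => universal D f m i j) m 1 ∧
      form (defect f (fun i j => universal D f m i j) m 1) = vacuumForm := by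
  rw [defect_eq_listDefect fun i => summable_phiTerm_universal hm i 1]
  exact listDefect_of_form_eq _ hm zero_le_one listWeightForm_vacuumForm.symm

end Universal

end Polydomain

namespace Polydomain

variable {k : ℕ} {n : Fin k → ℕ}

/-! ### Compressions to coinvariant subspaces -/

section Compression

variable {S : Type*} [NormedAddCommGroup S] [InnerProductSpace ℂ S] [CompleteSpace S]
variable {F : Type*} [NormedAddCommGroup F] [InnerProductSpace ℂ F] [CompleteSpace F]

theorem intertwine_adjoint_wordOp {N : ℕ} {M : Fin N → (S →L[ℂ] S)} {W : Fin N → (F →L[ℂ] F)}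
    {C : S →L[ℂ] F}
    (h : ∀ j s, C (ContinuousLinearMap.adjoint (M j) s) = ContinuousLinearMap.adjoint (W j) (C s))
    (α : FreeMonoid (Fin N)) (s : S) :
    C (ContinuousLinearMap.adjoint (wordOp M α) s) =
      ContinuousLinearMap.adjoint (wordOp W α) (C s) := by
  induction α using FreeMonoid.inductionOn' generalizing s with
  | one => rw [adjoint_wordOp_one, adjoint_wordOp_one]
  | of_mul a α ih => rw [adjoint_wordOp_mul, adjoint_wordOp_mul, ih, wordOp_of, wordOp_of, h]

theorem phi_compression {N : ℕ} {f : PosRegular N} {M : Fin N → (S →L[ℂ] S)}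
    {W : Fin N → (F →L[ℂ] F)} {C : S →L[ℂ] F}
    (h : ∀ j s, C (ContinuousLinearMap.adjoint (M j) s) = ContinuousLinearMap.adjoint (W j) (C s))
    {Z : F →L[ℂ] F} (hW : Summable (phiTerm f W Z)) :
    phi f M (ContinuousLinearMap.adjoint C ∘L Z ∘L C) =
      ContinuousLinearMap.adjoint C ∘L phi f W Z ∘L C := by
  have h1 : HasSum (phiTerm f M (ContinuousLinearMap.adjoint C ∘L Z ∘L C))
      (ContinuousLinearMapWOT.ofCLM (ContinuousLinearMap.adjoint C ∘L phi f W Z ∘L C)) := by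
    refine hasSum_wot_iff.mpr fun u v => ?_
    have h2 := hasSum_inner_phi hW (C u) (C v)
    have h3 : inner ℂ u ((ContinuousLinearMapWOT.ofCLM
        (ContinuousLinearMap.adjoint C ∘L phi f W Z ∘L C) : S →WOT[ℂ] S) v) =
        inner ℂ (C u) (phi f W Z (C v)) := ContinuousLinearMap.adjoint_inner_right C u _
    rw [h3]
    have h4 : (fun α => inner ℂ u (phiTerm f M (ContinuousLinearMap.adjoint C ∘L Z ∘L C) α v)) =
        fun α => (f.coeff α : ℂ) * inner ℂ (ContinuousLinearMap.adjoint (wordOp W α) (C u))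
          (Z (ContinuousLinearMap.adjoint (wordOp W α) (C v))) := by
      funext α
      rw [inner_phiTerm, ← intertwine_adjoint_wordOp h, ← intertwine_adjoint_wordOp h]
      congr 1
      exact ContinuousLinearMap.adjoint_inner_right C _ _
    rw [h4]
    exact h2
  rw [phi, h1.tsum_eq]

variable {f : ∀ i, PosRegular (n i)} {m : Fin k → ℕ} {M : OpTuple n S} {W : OpTuple n F}
  {C : S →L[ℂ] F}

theorem defect_compression
    (h : ∀ i j s, C (ContinuousLinearMap.adjoint (M i j) s) =
      ContinuousLinearMap.adjoint (W i j) (C s))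
    (hW : ∀ i, Summable (phiTerm (f i) (W i) 1)) (p : Fin k → ℕ) (Z : F →L[ℂ] F) :
    defect f M p (ContinuousLinearMap.adjoint C ∘L Z ∘L C) =
      ContinuousLinearMap.adjoint C ∘L defect f W p Z ∘L C := by
  have hit : ∀ i (r : ℕ) (Y : F →L[ℂ] F),
      (fun Y' => Y' - phi (f i) (M i) Y')^[r] (ContinuousLinearMap.adjoint C ∘L Y ∘L C) =
        ContinuousLinearMap.adjoint C ∘L ((fun Y' => Y' - phi (f i) (W i) Y')^[r] Y) ∘L C := by
    intro i r
    induction r with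
    | zero => exact fun Y => rfl
    | succ r ih =>
      intro Y
      rw [Function.iterate_succ_apply, Function.iterate_succ_apply, ← ih,
        phi_compression (h i) (summable_phiTerm (hW i) Y), ContinuousLinearMap.sub_comp,
        ContinuousLinearMap.comp_sub]
  unfold defect
  induction List.finRange k with
  | nil => rfl
  | cons i l ih => rw [List.foldr_cons, List.foldr_cons, ih, hit]

theorem intertwine_adjointWords
    (h : ∀ i j s, C (ContinuousLinearMap.adjoint (M i j) s) =
      ContinuousLinearMap.adjoint (W i j) (C s)) (β : Words n) (s : S) :
    C (adjointWords M β s) = adjointWords W β (C s) := by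
  unfold adjointWords
  induction List.finRange k with
  | nil => rfl
  | cons i l ih =>
    rw [List.map_cons, List.map_cons, List.prod_cons, List.prod_cons, mul_apply_eq_comp,
      mul_apply_eq_comp, intertwine_adjoint_wordOp (h i), ih]

theorem commute_compression
    (h : ∀ i j s, C (ContinuousLinearMap.adjoint (M i j) s) =
      ContinuousLinearMap.adjoint (W i j) (C s)) (hC : Function.Injective C)
    {i p : Fin k} {a : Fin (n i)} {b : Fin (n p)} (hW : Commute (W i a) (W p b)) :
    Commute (M i a) (M p b) := by
  have h1 : ContinuousLinearMap.adjoint (M i a * M p b) =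
      ContinuousLinearMap.adjoint (M p b * M i a) := by
    simp only [ContinuousLinearMap.mul_def, ContinuousLinearMap.adjoint_comp]
    refine ContinuousLinearMap.ext fun s => hC ?_
    simp only [ContinuousLinearMap.comp_apply, h]
    exact congrArg (fun A : F →L[ℂ] F => A (C s)) (Commute.adjoint hW).eq.symm
  exact ContinuousLinearMap.adjoint.injective h1

theorem form_compression (Z : F →L[ℂ] F) (s : S) :
    form (ContinuousLinearMap.adjoint C ∘L Z ∘L C) s = form Z (C s) := by
  rw [form, ContinuousLinearMap.comp_apply, ContinuousLinearMap.adjoint_inner_right]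
  rfl

theorem compression_nonneg {Z : F →L[ℂ] F} (hZ : 0 ≤ Z) :
    0 ≤ ContinuousLinearMap.adjoint C ∘L Z ∘L C := by
  rw [ContinuousLinearMap.nonneg_iff_isPositive] at hZ ⊢
  exact hZ.adjoint_conj C

end Compression

section UniversalCompression

variable {S : Type*} [NormedAddCommGroup S] [InnerProductSpace ℂ S] [CompleteSpace S]
variable {E : Type*} [NormedAddCommGroup E] [InnerProductSpace ℂ E] [CompleteSpace E]
variable {f : ∀ i, PosRegular (n i)} {m : Fin k → ℕ} {M : OpTuple n S} {C : S →L[ℂ] Fock n E}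

/-- The defect of `M` is C^*ΔC with Δ the vacuum projection, so its Berezin sum at s is that of the
universal model at C s, namely ‖C s‖² = ‖s‖². Positivity and existence of the kernel come out of the
same identity. -/
theorem berezinKernel_of_universal_compression (hm : ∀ i, 1 ≤ m i)
    (h : ∀ i j s, C (ContinuousLinearMap.adjoint (M i j) s) =
      ContinuousLinearMap.adjoint (universal E f m i j) (C s)) (hC : ∀ s, ‖C s‖ = ‖s‖) :
    IsBerezinKernel f m M (berezinKernel f m M) ∧ (∀ s, ‖berezinKernel f m M s‖ = ‖s‖) ∧
      ∀ i j s, berezinKernel f m M (ContinuousLinearMap.adjoint (M i j) s) =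
        ContinuousLinearMap.adjoint (universal (defectSpace f m M) f m i j)
          (berezinKernel f m M s) := by
  let W : OpTuple n (Fock n E) := fun i j => universal E f m i j
  have hCC : ContinuousLinearMap.adjoint C ∘L (1 : Fock n E →L[ℂ] Fock n E) ∘L C = 1 :=
    (ContinuousLinearMap.norm_map_iff_adjoint_comp_self C).mp hC
  have hW : ∀ i, Summable (phiTerm (f i) (W i) 1) := fun i => summable_phiTerm_universal hm i 1
  have hdef := defect_compression (f := f) (M := M) (W := W) h hW m 1
  rw [hCC] at hdef
  obtain ⟨hnn, hform⟩ := defect_universal (D := E) (f := f) hm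
  have hΔ : 0 ≤ defect f M m 1 := by
    rw [hdef]
    exact compression_nonneg hnn
  have hsum : ∀ s, listWeightForm f m M (List.finRange k) (form (defect f M m 1)) s =
      ENNReal.ofReal (‖s‖ ^ 2) := fun s => by
    have h1 := congrFun (listWeightForm_vacuumForm (D := E) (f := f) (m := m)) (C s)
    rw [form_one, ← tsum_words] at h1
    simp only [hC] at h1
    rw [← h1, ← tsum_words]
    refine tsum_congr fun β => ?_
    rw [hdef, form_compression, ← hform, intertwine_adjointWords (W := W) h]
  have hK := isBerezinKernel_berezinKernel (exists_isBerezinKernel hΔ fun s => (hsum s).le)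
  refine ⟨hK, fun s => ?_, fun i j s => hK.intertwine (fun p q hpq a b => ?_) i j s⟩
  · have h1 := (hK.ofReal_norm_sq hΔ s).trans (hsum s)
    rw [ENNReal.ofReal_eq_ofReal_iff (sq_nonneg _) (sq_nonneg _)] at h1
    exact (sq_eq_sq₀ (norm_nonneg _) (norm_nonneg _)).mp h1
  · refine commute_compression (W := W) h ?_ (universal_commute hpq a b)
    exact (AddMonoidHomClass.isometry_of_norm C hC).injective

end UniversalCompression

/-! ### Isometries and partial isometries -/

section PartialIsometry

variable {H : Type*} [NormedAddCommGroup H] [InnerProductSpace ℂ H] [CompleteSpace H]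
variable {F : Type*} [NormedAddCommGroup F] [InnerProductSpace ℂ F] [CompleteSpace F]
variable {G : Type*} [NormedAddCommGroup G] [InnerProductSpace ℂ G] [CompleteSpace G]
variable {K : H →L[ℂ] F} {L : F →L[ℂ] G}

theorem apply_kernel_eq_zero
    (h : ∀ x, ContinuousLinearMap.adjoint L (L x) = x - K (ContinuousLinearMap.adjoint K x))
    (hK : ∀ y, ‖K y‖ = ‖y‖) (y : H) : L (K y) = 0 := by
  have h1 : ContinuousLinearMap.adjoint K (K y) = y :=
    congrArg (fun A : H →L[ℂ] H => A y)
      ((ContinuousLinearMap.norm_map_iff_adjoint_comp_self K).mp hK)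
  rw [← inner_self_eq_zero (𝕜 := ℂ), ← ContinuousLinearMap.adjoint_inner_left, h, h1, sub_self,
    inner_zero_left]

theorem isPartialIsometry_adjoint_of_isometry
    (h : ∀ x, ContinuousLinearMap.adjoint L (L x) = x - K (ContinuousLinearMap.adjoint K x))
    (hK : ∀ y, ‖K y‖ = ‖y‖) : IsPartialIsometry (ContinuousLinearMap.adjoint L) := by
  intro x hx
  have hKL : ∀ z, ContinuousLinearMap.adjoint K (ContinuousLinearMap.adjoint L z) = 0 := fun z => by
    refine ext_inner_left ℂ fun y => ?_
    rw [ContinuousLinearMap.adjoint_inner_right, ContinuousLinearMap.adjoint_inner_right,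
      apply_kernel_eq_zero h hK, inner_zero_left, inner_zero_right]
  -- This difference d satisfies L^* d = 0 because K^* L^* = 0. Hence d is orthogonal to L L^* x,
  -- and it is orthogonal to x by the choice of x; so ⟨d, d⟩ = 0.
  have h1 : L (ContinuousLinearMap.adjoint L x) - x = 0 := by
    rw [← inner_self_eq_zero (𝕜 := ℂ)]
    have hker : L (ContinuousLinearMap.adjoint L x) - x ∈
        LinearMap.ker (ContinuousLinearMap.adjoint L).toLinearMap := by
      rw [LinearMap.mem_ker]
      change ContinuousLinearMap.adjoint L (L (ContinuousLinearMap.adjoint L x) - x) = 0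
      rw [map_sub, h, hKL, map_zero, sub_zero, sub_self]
    nth_rw 2 [← sub_zero (L (ContinuousLinearMap.adjoint L x) - x)]
    have h2 := hx _ hker
    have h3 : inner ℂ (L (ContinuousLinearMap.adjoint L x) - x)
        (L (ContinuousLinearMap.adjoint L x)) = 0 := by
      rw [← ContinuousLinearMap.adjoint_inner_left]
      rw [show ContinuousLinearMap.adjoint L (L (ContinuousLinearMap.adjoint L x) - x) = 0 from
        hker, inner_zero_left]
    rw [sub_zero, inner_sub_right, h3, h2, sub_zero]
  have h4 : ‖ContinuousLinearMap.adjoint L x‖ ^ 2 = ‖x‖ ^ 2 := by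
    rw [← inner_self_eq_norm_sq (𝕜 := ℂ), ContinuousLinearMap.adjoint_inner_left,
      sub_eq_zero.mp h1, inner_self_eq_norm_sq]
  exact (sq_eq_sq₀ (norm_nonneg _) (norm_nonneg _)).mp h4

/-- If L^* is a partial isometry, then P = L^*L is a projection, hence so is K K^* = 1 - P.
Cancelling the injective K in K K^*K K^* = K K^* gives K^*K K^* = K^*; taking adjoints and
cancelling again gives K^*K = 1. -/
theorem isometry_of_isPartialIsometry_adjoint
    (h : ∀ x, ContinuousLinearMap.adjoint L (L x) = x - K (ContinuousLinearMap.adjoint K x))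
    (hK : ∀ y, K y = 0 → y = 0) (hL : IsPartialIsometry (ContinuousLinearMap.adjoint L)) (y : H) :
    ‖K y‖ = ‖y‖ := by
  set P := ContinuousLinearMap.adjoint L ∘L L with hP
  have hPsa : ∀ u v, inner ℂ (P u) v = inner ℂ u (P v) := fun u v => by
    change inner ℂ (ContinuousLinearMap.adjoint L (L u)) v =
      inner ℂ u (ContinuousLinearMap.adjoint L (L v))
    rw [ContinuousLinearMap.adjoint_inner_left, ContinuousLinearMap.adjoint_inner_right]
  -- The range of L is orthogonal to the kernel of L^*, so L^* is isometric on it.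
  have h1 : ∀ x, ‖P x‖ = ‖L x‖ := fun x => hL (L x) fun z hz => by
    rw [← ContinuousLinearMap.adjoint_inner_left,
      show ContinuousLinearMap.adjoint L z = 0 from hz, inner_zero_left]
  have h2 : (P * P).toLinearMap = P.toLinearMap := by
    rw [← ext_inner_map]
    intro x
    change inner ℂ (P (P x)) x = inner ℂ (P x) x
    have h3 : inner ℂ (P x) x = inner ℂ (L x) (L x) :=
      ContinuousLinearMap.adjoint_inner_left L x (L x)
    rw [hPsa, h3, inner_self_eq_norm_sq_to_K, inner_self_eq_norm_sq_to_K, h1]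
  have hPP : ∀ x, P (P x) = P x := fun x => LinearMap.congr_fun h2 x
  have h4 : ∀ x, K (ContinuousLinearMap.adjoint K x) = x - P x := fun x => by
    rw [hP, ContinuousLinearMap.comp_apply, h, sub_sub_cancel]
  have h5 : ∀ x, ContinuousLinearMap.adjoint K (K (ContinuousLinearMap.adjoint K x)) =
      ContinuousLinearMap.adjoint K x := fun x => by
    rw [← sub_eq_zero]
    refine hK _ ?_
    rw [map_sub, h4, h4, map_sub, hPP, sub_self, sub_zero, sub_self]
  have h6 : ContinuousLinearMap.adjoint K (K y) = y := by
    rw [← sub_eq_zero]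
    refine hK _ (ext_inner_left ℂ fun x => ?_)
    rw [← ContinuousLinearMap.adjoint_inner_left, inner_sub_right, inner_zero_right,
      ContinuousLinearMap.adjoint_inner_right, ← ContinuousLinearMap.adjoint_inner_left K y,
      h5, sub_self]
  have h7 : ‖K y‖ ^ 2 = ‖y‖ ^ 2 := by
    rw [← inner_self_eq_norm_sq (𝕜 := ℂ), ← ContinuousLinearMap.adjoint_inner_left, h6,
      inner_self_eq_norm_sq]
  exact (sq_eq_sq₀ (norm_nonneg _) (norm_nonneg _)).mp h7

end PartialIsometry

end Polydomain

namespace Polydomain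

universe u

/-! ### The square root of a positive operator, restricted to the closure of the range -/

section SqrtRange

variable {F : Type*} [NormedAddCommGroup F] [InnerProductSpace ℂ F] [CompleteSpace F]

/-- The closure of the range of an operator. -/
abbrev rangeClosure (Y : F →L[ℂ] F) : Submodule ℂ F :=
  (LinearMap.range Y.toLinearMap).topologicalClosure

variable {Y : F →L[ℂ] F} (hY : 0 ≤ Y)

/-- The square root of `Y`, as an operator into the closure of the range of `Y`. -/
noncomputable def sqrtRange : F →L[ℂ] rangeClosure Y :=
  (opSqrt Y).codRestrict (rangeClosure Y) (opSqrt_apply_mem hY)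

theorem adjoint_sqrtRange :
    ContinuousLinearMap.adjoint (sqrtRange hY) = opSqrt Y ∘L (rangeClosure Y).subtypeL := by
  refine ((ContinuousLinearMap.eq_adjoint_iff _ _).mpr fun s x => ?_).symm
  change inner ℂ (opSqrt Y s) x = inner ℂ (s : F) (opSqrt Y x)
  rw [← ContinuousLinearMap.adjoint_inner_right, adjoint_opSqrt]

theorem adjoint_sqrtRange_apply (x : F) :
    ContinuousLinearMap.adjoint (sqrtRange hY) (sqrtRange hY x) = Y x := by
  rw [adjoint_sqrtRange]
  exact opSqrt_opSqrt_apply hY x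

/-- A vector orthogonal to the range of Y^{1/2} is orthogonal to that of Y = Y^{1/2}Y^{1/2}; if it
also lies in the closure of the range of Y, it is zero. -/
theorem denseRange_sqrtRange : DenseRange (sqrtRange hY) := by
  have h1 : (LinearMap.range (sqrtRange hY).toLinearMap).topologicalClosure = ⊤ := by
    rw [Submodule.topologicalClosure_eq_top_iff, Submodule.eq_bot_iff]
    intro s hs
    have h2 : (s : F) ∈ (LinearMap.range Y.toLinearMap)ᗮ := by
      rintro _ ⟨x, rfl⟩
      have h3 := hs (sqrtRange hY (opSqrt Y x)) ⟨_, rfl⟩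
      rw [Submodule.coe_inner] at h3
      change inner ℂ (opSqrt Y (opSqrt Y x)) (s : F) = 0 at h3
      rw [opSqrt_opSqrt_apply hY] at h3
      exact h3
    have h4 : (s : F) ∈ (LinearMap.range Y.toLinearMap).topologicalClosure := s.2
    rw [← Submodule.orthogonal_orthogonal_eq_closure] at h4
    exact Subtype.ext (inner_self_eq_zero.mp (h4 _ h2))
  have h2 := (Submodule.dense_iff_topologicalClosure_eq_top).mpr h1
  rwa [LinearMap.coe_range] at h2

variable {G : Type*} [NormedAddCommGroup G] [InnerProductSpace ℂ G] [CompleteSpace G]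

/-- A factorization `Y = Ψ Ψ^*` gives an isometry `C` with `C Y^{1/2} = Ψ^*`. -/
theorem exists_isometry_of_factorization {Ψ : G →L[ℂ] F}
    (hΨ : Y = Ψ ∘L ContinuousLinearMap.adjoint Ψ) :
    ∃ C : rangeClosure Y →L[ℂ] G, (∀ s, ‖C s‖ = ‖s‖) ∧
      ∀ x, C (sqrtRange hY x) = ContinuousLinearMap.adjoint Ψ x := by
  have hdense := denseRange_sqrtRange hY
  -- Both squared norms are ⟨Y x, x⟩, so Y^{1/2}x ↦ Ψ^*x is well defined and isometric on a dense
  -- subspace.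
  have hnorm : ∀ x, ‖ContinuousLinearMap.adjoint Ψ x‖ = ‖sqrtRange hY x‖ := fun x => by
    have h1 : ‖ContinuousLinearMap.adjoint Ψ x‖ ^ 2 = ‖sqrtRange hY x‖ ^ 2 := by
      rw [← inner_self_eq_norm_sq (𝕜 := ℂ) (sqrtRange hY x),
        ← ContinuousLinearMap.adjoint_inner_left, adjoint_sqrtRange_apply,
        ← inner_self_eq_norm_sq (𝕜 := ℂ), ContinuousLinearMap.adjoint_inner_right]
      exact congrArg (fun A : F →L[ℂ] F => RCLike.re (inner ℂ (A x) x)) hΨ.symm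
    exact (sq_eq_sq₀ (norm_nonneg _) (norm_nonneg _)).mp h1
  let C : rangeClosure Y →L[ℂ] G :=
    (ContinuousLinearMap.adjoint Ψ).toLinearMap.extendOfNorm (sqrtRange hY).toLinearMap
  have hCR : ∀ x, C (sqrtRange hY x) = ContinuousLinearMap.adjoint Ψ x := fun x =>
    LinearMap.extendOfNorm_eq hdense ⟨1, fun y => by rw [one_mul]; exact (hnorm y).le⟩ x
  exact ⟨C, fun s => congrFun (hdense.equalizer (C.continuous.norm) continuous_norm
    (funext fun x => by simp only [Function.comp_apply]; rw [hCR, hnorm])) s, hCR⟩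

theorem exists_compression {Ψ : G →L[ℂ] F} {C : rangeClosure Y →L[ℂ] G} (hC : ∀ s, ‖C s‖ = ‖s‖)
    (hCR : ∀ x, C (sqrtRange hY x) = ContinuousLinearMap.adjoint Ψ x) {V : F →L[ℂ] F}
    {W : G →L[ℂ] G} (hmul : Ψ ∘L W = V ∘L Ψ) :
    ∃ A : rangeClosure Y →L[ℂ] rangeClosure Y,
      ∀ x, A (sqrtRange hY x) = sqrtRange hY (ContinuousLinearMap.adjoint V x) := by
  have hCC : ∀ s, ContinuousLinearMap.adjoint C (C s) = s := fun s =>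
    congrArg (fun A : rangeClosure Y →L[ℂ] rangeClosure Y => A s)
      ((ContinuousLinearMap.norm_map_iff_adjoint_comp_self C).mp hC)
  refine ⟨ContinuousLinearMap.adjoint C ∘L ContinuousLinearMap.adjoint W ∘L C, fun x => ?_⟩
  have h1 := congrArg ContinuousLinearMap.adjoint hmul
  rw [ContinuousLinearMap.adjoint_comp, ContinuousLinearMap.adjoint_comp] at h1
  have h2 := congrArg (fun A : F →L[ℂ] G => A x) h1
  simp only [ContinuousLinearMap.comp_apply] at h2
  rw [ContinuousLinearMap.comp_apply, ContinuousLinearMap.comp_apply, hCR, h2, ← hCR, hCC]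

/-- Stated for any `A` satisfying the defining relation, since the companion operators are obtained
by choice. Both sides agree on the dense range of Y^{1/2}. -/
theorem intertwine_of_sqrtRange {Ψ : G →L[ℂ] F} {C : rangeClosure Y →L[ℂ] G}
    (hCR : ∀ x, C (sqrtRange hY x) = ContinuousLinearMap.adjoint Ψ x) {V : F →L[ℂ] F}
    {W : G →L[ℂ] G} (hmul : Ψ ∘L W = V ∘L Ψ) {A : rangeClosure Y →L[ℂ] rangeClosure Y}
    (hA : ∀ x, A (sqrtRange hY x) = sqrtRange hY (ContinuousLinearMap.adjoint V x))
    (s : rangeClosure Y) : C (A s) = ContinuousLinearMap.adjoint W (C s) := by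
  refine congrFun ((denseRange_sqrtRange hY).equalizer (C.continuous.comp A.continuous)
    ((ContinuousLinearMap.adjoint W).continuous.comp C.continuous) (funext fun x => ?_)) s
  have h1 := congrArg ContinuousLinearMap.adjoint hmul
  rw [ContinuousLinearMap.adjoint_comp, ContinuousLinearMap.adjoint_comp] at h1
  have h2 := congrArg (fun A : F →L[ℂ] G => A x) h1
  simp only [ContinuousLinearMap.comp_apply] at h2
  simp only [Function.comp_apply]
  rw [hA, hCR, hCR, h2]

theorem adjoint_comp_sqrtRange (J : rangeClosure Y →L[ℂ] G) :
    ContinuousLinearMap.adjoint (J ∘L sqrtRange hY) =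
      opSqrt Y ∘L (rangeClosure Y).subtypeL ∘L ContinuousLinearMap.adjoint J := by
  rw [ContinuousLinearMap.adjoint_comp, adjoint_sqrtRange]
  rfl

theorem adjoint_comp_sqrtRange_apply {J : rangeClosure Y →L[ℂ] G} (hJ : ∀ s, ‖J s‖ = ‖s‖) (x : F) :
    ContinuousLinearMap.adjoint (J ∘L sqrtRange hY) ((J ∘L sqrtRange hY) x) = Y x := by
  have h1 : ∀ s, ContinuousLinearMap.adjoint J (J s) = s := fun s =>
    congrArg (fun A : rangeClosure Y →L[ℂ] rangeClosure Y => A s)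
      ((ContinuousLinearMap.norm_map_iff_adjoint_comp_self J).mp hJ)
  rw [ContinuousLinearMap.adjoint_comp, ContinuousLinearMap.comp_apply,
    ContinuousLinearMap.comp_apply, h1, adjoint_sqrtRange_apply]

theorem opSqrt_comp_adjoint {V : F →L[ℂ] F} {A : rangeClosure Y →L[ℂ] rangeClosure Y}
    (hA : ∀ x, A (sqrtRange hY x) = sqrtRange hY (ContinuousLinearMap.adjoint V x)) :
    opSqrt Y ∘L (rangeClosure Y).subtypeL ∘L ContinuousLinearMap.adjoint A =
      V ∘L opSqrt Y ∘L (rangeClosure Y).subtypeL := by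
  rw [← ContinuousLinearMap.comp_assoc, ← adjoint_sqrtRange hY]
  refine ContinuousLinearMap.ext fun x => ext_inner_right ℂ fun y => ?_
  simp only [ContinuousLinearMap.comp_apply]
  rw [← ContinuousLinearMap.adjoint_inner_right V, ContinuousLinearMap.adjoint_inner_left,
    ContinuousLinearMap.adjoint_inner_left, ContinuousLinearMap.adjoint_inner_left, hA]

end SqrtRange

/-! ### The model -/

section Model

variable {H : Type*} [NormedAddCommGroup H] [InnerProductSpace ℂ H] [CompleteSpace H]
variable {F : Type*} [NormedAddCommGroup F] [InnerProductSpace ℂ F] [CompleteSpace F]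
variable {G : Type*} [NormedAddCommGroup G] [InnerProductSpace ℂ G] [CompleteSpace G]

/-- The complement of the range of L^* is the kernel of L. On it y = K K^* y, so it is exactly the
range of K. -/
theorem exists_unitary_of_isometry {K : H →L[ℂ] F} {L : F →L[ℂ] G} {Θ : G →L[ℂ] F}
    (hΘ : ContinuousLinearMap.adjoint L = Θ)
    (h : ∀ x, ContinuousLinearMap.adjoint L (L x) = x - K (ContinuousLinearMap.adjoint K x))
    (hK : ∀ y, ‖K y‖ = ‖y‖) :
    ∃ U : H ≃ₗᵢ[ℂ] (LinearMap.range Θ.toLinearMap)ᗮ, ∀ y, (U y : F) = K y := by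
  subst hΘ
  have hmem : ∀ y : F, y ∈ (LinearMap.range (ContinuousLinearMap.adjoint L).toLinearMap)ᗮ ↔
      L y = 0 := fun y => by
    rw [ContinuousLinearMap.orthogonal_range, ContinuousLinearMap.adjoint_adjoint]
    rfl
  let V : H →ₗᵢ[ℂ] (LinearMap.range (ContinuousLinearMap.adjoint L).toLinearMap)ᗮ :=
    { toLinearMap := K.toLinearMap.codRestrict _
        fun y => (hmem _).mpr (apply_kernel_eq_zero h hK y)
      norm_map' := hK }
  have hV : Function.Surjective V := fun y => by
    have h1 := h (y : F)
    rw [(hmem _).mp y.2, map_zero] at h1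
    exact ⟨ContinuousLinearMap.adjoint K y, Subtype.ext (sub_eq_zero.mp h1.symm).symm⟩
  exact ⟨LinearIsometryEquiv.ofSurjective V hV, fun y => rfl⟩

/-- Pairing with U z moves both operators to their adjoints, where the intertwining applies; the
projection drops out because U z lies in `S`. -/
theorem eq_symm_compression {K : H →L[ℂ] F} {S : Submodule ℂ F} [S.HasOrthogonalProjection]
    (U : H ≃ₗᵢ[ℂ] S) (hU : ∀ y, (U y : F) = K y) {A : H →L[ℂ] H} {V : F →L[ℂ] F}
    (hA : ∀ y, K (ContinuousLinearMap.adjoint A y) = ContinuousLinearMap.adjoint V (K y)) (y : H) :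
    A y = U.symm ((S.orthogonalProjectionOnto ∘L V ∘L S.subtypeL) (U y)) := by
  rw [LinearIsometryEquiv.eq_symm_apply]
  refine ext_inner_right ℂ fun z => ?_
  obtain ⟨z, rfl⟩ := U.surjective z
  rw [LinearIsometryEquiv.inner_map_map, ContinuousLinearMap.comp_apply,
    Submodule.inner_orthogonalProjectionOnto_eq_of_mem_right, ContinuousLinearMap.comp_apply,
    ← ContinuousLinearMap.adjoint_inner_right, ← ContinuousLinearMap.adjoint_inner_right, hU, ← hA,
    ← hU, Submodule.subtypeL_apply, ← Submodule.coe_inner, LinearIsometryEquiv.inner_map_map]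

/-- Sufficient data for the factorization `I - K K^* = Θ Θ^*` with `Θ = Y^{1/2} J^*`. -/
theorem adjoint_comp_sqrtRange_kernel {Y : F →L[ℂ] F} (hY : 0 ≤ Y) {K : H →L[ℂ] F}
    (hYK : Y = 1 - K ∘L ContinuousLinearMap.adjoint K) {J : rangeClosure Y →L[ℂ] G}
    (hJ : ∀ s, ‖J s‖ = ‖s‖) (x : F) :
    ContinuousLinearMap.adjoint (J ∘L sqrtRange hY) ((J ∘L sqrtRange hY) x) =
      x - K (ContinuousLinearMap.adjoint K x) :=
  (adjoint_comp_sqrtRange_apply hY hJ x).trans (congrArg (fun A : F →L[ℂ] F => A x) hYK)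

theorem isPartialIsometry_opSqrt_comp {Y : F →L[ℂ] F} (hY : 0 ≤ Y) {K : H →L[ℂ] F}
    (hYK : Y = 1 - K ∘L ContinuousLinearMap.adjoint K) {J : rangeClosure Y →L[ℂ] G}
    (hJ : ∀ s, ‖J s‖ = ‖s‖) (hK : ∀ y, ‖K y‖ = ‖y‖) :
    IsPartialIsometry
      (opSqrt Y ∘L (rangeClosure Y).subtypeL ∘L ContinuousLinearMap.adjoint J) := by
  rw [← adjoint_comp_sqrtRange hY]
  exact isPartialIsometry_adjoint_of_isometry (adjoint_comp_sqrtRange_kernel hY hYK hJ) hK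

theorem isometry_of_isPartialIsometry_opSqrt_comp {Y : F →L[ℂ] F} (hY : 0 ≤ Y) {K : H →L[ℂ] F}
    (hYK : Y = 1 - K ∘L ContinuousLinearMap.adjoint K) {J : rangeClosure Y →L[ℂ] G}
    (hJ : ∀ s, ‖J s‖ = ‖s‖) (hK : ∀ y, K y = 0 → y = 0)
    (h : IsPartialIsometry
      (opSqrt Y ∘L (rangeClosure Y).subtypeL ∘L ContinuousLinearMap.adjoint J)) (y : H) :
    ‖K y‖ = ‖y‖ := by
  rw [← adjoint_comp_sqrtRange hY] at h
  exact isometry_of_isPartialIsometry_adjoint (adjoint_comp_sqrtRange_kernel hY hYK hJ) hK h y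

theorem exists_unitary_of_opSqrt_comp {Y : F →L[ℂ] F} (hY : 0 ≤ Y) {K : H →L[ℂ] F}
    (hYK : Y = 1 - K ∘L ContinuousLinearMap.adjoint K) {J : rangeClosure Y →L[ℂ] G}
    (hJ : ∀ s, ‖J s‖ = ‖s‖) (hK : ∀ y, ‖K y‖ = ‖y‖) :
    ∃ U : H ≃ₗᵢ[ℂ] (LinearMap.range (opSqrt Y ∘L (rangeClosure Y).subtypeL ∘L
      ContinuousLinearMap.adjoint J).toLinearMap)ᗮ, ∀ y, (U y : F) = K y :=
  exists_unitary_of_isometry (adjoint_comp_sqrtRange hY J)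
    (adjoint_comp_sqrtRange_kernel hY hYK hJ) hK

end Model

/-! ### Characteristic functions -/

section CharFun

variable {k : ℕ} {n : Fin k → ℕ}
variable {H : Type u} [NormedAddCommGroup H] [InnerProductSpace ℂ H] [CompleteSpace H]
variable {f : ∀ i, PosRegular (n i)} {m : Fin k → ℕ} {T : OpTuple n H}

theorem kernelDefect_nonneg (hT : HasCharFun f m T) : 0 ≤ kernelDefect f m T := by
  obtain ⟨-, E, _, _, _, Ψ, -, hΨ⟩ := hT
  have h1 : kernelDefect f m T = Ψ ∘L ContinuousLinearMap.adjoint Ψ := sub_eq_of_eq_add' hΨ.symm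
  rw [h1, ContinuousLinearMap.nonneg_iff_isPositive]
  exact ContinuousLinearMap.isPositive_self_comp_adjoint Ψ

theorem companionAdjoint_sqrtRange (hT : HasCharFun f m T) {i : Fin k} {j : Fin (n i)}
    {A : kernelDefectSpace f m T →L[ℂ] kernelDefectSpace f m T}
    (hA : IsCompanionAdjoint f m T i j A) (x : Fock n (defectSpace f m T)) :
    A (sqrtRange (kernelDefect_nonneg hT) x) = sqrtRange (kernelDefect_nonneg hT)
      (ContinuousLinearMap.adjoint (universal (defectSpace f m T) f m i j) x) :=
  Subtype.ext (hA x (sqrtRange (kernelDefect_nonneg hT) x) rfl)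

theorem isCompanionAdjoint_of_sqrtRange (hT : HasCharFun f m T) {i : Fin k} {j : Fin (n i)}
    {A : kernelDefectSpace f m T →L[ℂ] kernelDefectSpace f m T}
    (hA : ∀ x, A (sqrtRange (kernelDefect_nonneg hT) x) = sqrtRange (kernelDefect_nonneg hT)
      (ContinuousLinearMap.adjoint (universal (defectSpace f m T) f m i j) x)) :
    IsCompanionAdjoint f m T i j A := fun x y hy => by
  obtain rfl : y = sqrtRange (kernelDefect_nonneg hT) x := Subtype.ext hy
  exact congrArg Subtype.val (hA x)

/-- The companion tuple is a compression of a universal model. -/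
theorem exists_companion_dilation (hT : HasCharFun f m T) :
    (∀ i j, IsCompanionAdjoint f m T i j (companionAdjoint f m T i j)) ∧
    ∃ (E : Type u) (_ : NormedAddCommGroup E) (_ : InnerProductSpace ℂ E) (_ : CompleteSpace E)
      (C : kernelDefectSpace f m T →L[ℂ] Fock n E), (∀ s, ‖C s‖ = ‖s‖) ∧
      ∀ i j s, C (companionAdjoint f m T i j s) =
        ContinuousLinearMap.adjoint (universal E f m i j) (C s) := by
  obtain ⟨-, E, i₁, i₂, i₃, Ψ, hmul, hΨ⟩ := id hT
  obtain ⟨C, hC, hCR⟩ := exists_isometry_of_factorization (kernelDefect_nonneg hT)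
    (Ψ := Ψ) (sub_eq_of_eq_add' hΨ.symm)
  have hex : ∀ i j, ∃ A, IsCompanionAdjoint f m T i j A := fun i j => by
    obtain ⟨A, hA⟩ := exists_compression (kernelDefect_nonneg hT) hC hCR (hmul i j)
    exact ⟨A, isCompanionAdjoint_of_sqrtRange hT hA⟩
  have hA : ∀ i j, IsCompanionAdjoint f m T i j (companionAdjoint f m T i j) := fun i j => by
    rw [companionAdjoint, dif_pos (hex i j)]
    exact (hex i j).choose_spec
  exact ⟨hA, E, i₁, i₂, i₃, C, hC, fun i j s => intertwine_of_sqrtRange (kernelDefect_nonneg hT) hCR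
    (hmul i j) (companionAdjoint_sqrtRange hT (hA i j)) s⟩

theorem adjoint_companion (i : Fin k) (j : Fin (n i)) :
    ContinuousLinearMap.adjoint (companion f m T i j) = companionAdjoint f m T i j :=
  ContinuousLinearMap.adjoint_adjoint _

theorem isBerezinKernel_companion (hm : ∀ i, 1 ≤ m i) (hT : HasCharFun f m T) :
    IsBerezinKernel f m (companion f m T) (berezinKernel f m (companion f m T)) := by
  obtain ⟨-, E, _, _, _, C, hC, hCA⟩ := exists_companion_dilation hT
  exact (berezinKernel_of_universal_compression (M := companion f m T) (C := C) hm
    (fun i j s => by rw [adjoint_companion, hCA]) hC).1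

theorem isometry_berezinKernel_companion (hm : ∀ i, 1 ≤ m i) (hT : HasCharFun f m T)
    (s : kernelDefectSpace f m T) : ‖berezinKernel f m (companion f m T) s‖ = ‖s‖ := by
  obtain ⟨-, E, _, _, _, C, hC, hCA⟩ := exists_companion_dilation hT
  exact (berezinKernel_of_universal_compression (M := companion f m T) (C := C) hm
    (fun i j s => by rw [adjoint_companion, hCA]) hC).2.1 s

theorem berezinAdjoint_comp_universal {S E : Type*} [NormedAddCommGroup S]
    [InnerProductSpace ℂ S] [CompleteSpace S] [NormedAddCommGroup E] [InnerProductSpace ℂ E]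
    [CompleteSpace E] (hm : ∀ i, 1 ≤ m i) {M : OpTuple n S} {C : S →L[ℂ] Fock n E}
    (hint : ∀ i j s, C (ContinuousLinearMap.adjoint (M i j) s) =
      ContinuousLinearMap.adjoint (universal E f m i j) (C s)) (hC : ∀ s, ‖C s‖ = ‖s‖)
    (i : Fin k) (j : Fin (n i)) :
    berezinAdjoint f m M ∘L universal (defectSpace f m M) f m i j =
      M i j ∘L berezinAdjoint f m M := by
  have hJ := (berezinKernel_of_universal_compression hm hint hC).2.2 i j
  refine ContinuousLinearMap.ext fun x => ext_inner_right ℂ fun y => ?_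
  simp only [ContinuousLinearMap.comp_apply, berezinAdjoint]
  rw [← ContinuousLinearMap.adjoint_inner_right (M i j), ContinuousLinearMap.adjoint_inner_left,
    ContinuousLinearMap.adjoint_inner_left, hJ, ContinuousLinearMap.adjoint_inner_right]

/-- Two intertwinings compose: J^*(W ⊗ I) = A^* J^* for the Berezin kernel J of M_T, and Y^{1/2} A^*
= (W ⊗ I) Y^{1/2}, the adjoint of the relation defining A. -/
theorem isMultiAnalytic_charFun (hm : ∀ i, 1 ≤ m i) (hT : HasCharFun f m T) :
    IsMultiAnalytic f m (charFun f m T) := by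
  obtain ⟨hA, E, _, _, _, C, hC, hCA⟩ := exists_companion_dilation hT
  intro i j
  have h1 := berezinAdjoint_comp_universal (M := companion f m T) (C := C) hm
    (fun i j s => by rw [adjoint_companion, hCA]) hC i j
  have h2 : opSqrt (kernelDefect f m T) ∘L (kernelDefectSpace f m T).subtypeL ∘L
      companion f m T i j = universal (defectSpace f m T) f m i j ∘L
        opSqrt (kernelDefect f m T) ∘L (kernelDefectSpace f m T).subtypeL :=
    opSqrt_comp_adjoint (kernelDefect_nonneg hT) (companionAdjoint_sqrtRange hT (hA i j))
  refine ContinuousLinearMap.ext fun x => ?_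
  exact (congrArg (fun s : kernelDefectSpace f m T =>
    opSqrt (kernelDefect f m T) (s : Fock n (defectSpace f m T)))
      (DFunLike.congr_fun h1 x)).trans
    (DFunLike.congr_fun h2 (berezinAdjoint f m (companion f m T) x))

theorem isInner_charFun_of_isometry (hm : ∀ i, 1 ≤ m i) (hT : HasCharFun f m T)
    (hK : ∀ h, ‖berezinKernel f m T h‖ = ‖h‖) : IsInner f m (charFun f m T) :=
  ⟨isMultiAnalytic_charFun hm hT, isPartialIsometry_opSqrt_comp (kernelDefect_nonneg hT) rfl
    (isometry_berezinKernel_companion hm hT) hK⟩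

theorem isometry_of_isInner_charFun (hm : ∀ i, 1 ≤ m i) (hT : HasCharFun f m T)
    (hK : ∀ h, berezinKernel f m T h = 0 → h = 0) (hinner : IsInner f m (charFun f m T)) (h : H) :
    ‖berezinKernel f m T h‖ = ‖h‖ :=
  isometry_of_isPartialIsometry_opSqrt_comp (kernelDefect_nonneg hT) rfl
    (isometry_berezinKernel_companion hm hT) hK hinner.2 h

theorem unitarilyEquivalent_modelTuple (hm : ∀ i, 1 ≤ m i) (hT : HasCharFun f m T)
    (hK : ∀ h, ‖berezinKernel f m T h‖ = ‖h‖) : UnitarilyEquivalent T (modelTuple f m T) := by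
  obtain ⟨U, hU⟩ : ∃ U : H ≃ₗᵢ[ℂ] modelSpace f m T,
      ∀ y, (U y : Fock n (defectSpace f m T)) = berezinKernel f m T y :=
    exists_unitary_of_opSqrt_comp (kernelDefect_nonneg hT) rfl
      (isometry_berezinKernel_companion hm hT) hK
  exact ⟨U, fun i j y => eq_symm_compression U hU
    ((hT.1.isBerezinKernel hm).intertwine hT.1.commute i j) y⟩

end CharFun

end Polydomain

theorem mainTheorem11 {k : ℕ} {n m : Fin k → ℕ} (hn : ∀ i, 1 ≤ n i) (hm : ∀ i, 1 ≤ m i)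
    (f : ∀ i, PosRegular (n i))
    {H : Type*} [NormedAddCommGroup H] [InnerProductSpace ℂ H] [CompleteSpace H]
    (T : OpTuple n H) (hT : HasCharFun f m T) :
    -- the operators that define the characteristic function exist
    (IsBerezinKernel f m T (berezinKernel f m T) ∧
      (∀ i j, IsCompanionAdjoint f m T i j (companionAdjoint f m T i j)) ∧
      IsBerezinKernel f m (companion f m T) (berezinKernel f m (companion f m T))) ∧
    -- the characterization of purity
    (IsCNC f T → (IsPure f T ↔ IsInner f m (charFun f m T))) ∧
    -- in the pure case, the characteristic function is inner and gives a model
    (IsPure f T →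
      IsInner f m (charFun f m T) ∧ UnitarilyEquivalent T (modelTuple f m T)) := by
  -- Purity is used only as the statement that the Berezin kernel is isometric.
  have hpure := hT.1.isPure_iff hm
  refine ⟨⟨hT.1.isBerezinKernel hm, (exists_companion_dilation hT).1,
    isBerezinKernel_companion hm hT⟩, fun hcnc => ⟨fun h => ?_, fun h => ?_⟩, fun h => ⟨?_, ?_⟩⟩
  · exact isInner_charFun_of_isometry hm hT (hpure.mp h)
  · exact hpure.mpr (isometry_of_isInner_charFun hm hT
      (fun y hy => hT.1.injective_of_isCNC hm hcnc hy) h)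
  · exact isInner_charFun_of_isometry hm hT (hpure.mp h)
  · exact unitarilyEquivalent_modelTuple hm hT (hpure.mp h)
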